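/- Let $M$ be a connected smooth manifold of dimension $n$ with a smooth nondegenerate metric $g$ of arbitrary signature, let $R_{ij}$ be its Ricci tensor and $R=g^{ij}R_{ij}$ its curvature scalar. Assume that $(M,g)$ is a proper Einstein space, i.e. $R_{ij}=\frac{R}{n}g_{ij}$ with $R$ nowhere zero, and that $n>2$ or $R$ is constant. Let $\Lambda=\frac12 g_{ij}(x)\dot x^i\dot x^j$ be the geodesic Lagrangian. A vector field $X=\xi(t,x)\,\partial_t+\eta^i(t,x)\,\partial_i$ on $\mathbb R\times M$ with smooth $\xi,\eta$ is a Noether symmetry of $\Lambda$ if there is a smooth gauge function $f(t,x)$ such that $$X^{[1]}\Lambda+\frac{d\xi}{dt}\Lambda=\frac{df}{dt}$$ identically in $(t,x,\dot x)$, where $\frac{d}{dt}=\partial_t+\dot x^k\partial_k$ and $X^{[1]}=\xi\,\partial_t+\eta^i\,\partial_i+\left(\frac{d\eta^i}{dt}-\dot x^i\frac{d\xi}{dt}\right)\partial_{\dot x^i}$. Then the Noether symmetries of $\Lambda$ are exactly the vector fields $$X=L\,\partial_t+D^i(x)\,\partial_i,$$ where $L$ is a constant and $D=D^i(x)\partial_i$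 is a smooth non-gradient Killing vector field of $g$ (the zero field being admitted), that is, $\mathcal L_Dg=0$ and on every open set $U\subseteq M$ on which $D_i=\partial_iS$ for some smooth function $S$ the field $D$ vanishes. Moreover, every gauge function $f$ of a Noether symmetry of $\Lambda$ is constant. -/

import Mathlib

open scoped Manifold ContDiff Bundle

noncomputable section

namespace Geodesic

/-! ### Coordinate calculus on `ℝⁿ` -/

section Coordinates

variable {n : ℕ}

/-- The partial derivative `∂F/∂yⁱ` at `y`. -/
def pd (i : Fin n) (F : EuclideanSpace ℝ (Fin n) → ℝ) (y : EuclideanSpace ℝ (Fin n)) : ℝ :=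
  fderiv ℝ F y (EuclideanSpace.single i 1)

/-- The Christoffel symbols
`Γⁱⱼₖ = ½ gⁱˡ (gₗⱼ,ₖ + gₗₖ,ⱼ - gⱼₖ,ₗ)` of a matrix-valued function `G = (gᵢⱼ)`. -/
def christoffel (G : EuclideanSpace ℝ (Fin n) → Matrix (Fin n) (Fin n) ℝ)
    (i j k : Fin n) (y : EuclideanSpace ℝ (Fin n)) : ℝ :=
  1 / 2 * ∑ l, (G y)⁻¹ i l *
    (pd k (fun z => G z l j) y + pd j (fun z => G z l k) y - pd l (fun z => G z j k) y)

/-- The Ricci tensor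
`Rⱼₖ = Γⁱⱼₖ,ᵢ - Γⁱⱼᵢ,ₖ + Γⁱᵢₗ Γˡⱼₖ - Γⁱₖₗ Γˡⱼᵢ`. -/
def ricci (G : EuclideanSpace ℝ (Fin n) → Matrix (Fin n) (Fin n) ℝ)
    (j k : Fin n) (y : EuclideanSpace ℝ (Fin n)) : ℝ :=
  ∑ i, (pd i (christoffel G i j k) y - pd k (christoffel G i j i) y)
    + ∑ i, ∑ l, (christoffel G i i l y * christoffel G l j k y
        - christoffel G i k l y * christoffel G l j i y)

/-- The curvature scalar `R = gʲᵏ Rⱼₖ`. -/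
def scalar (G : EuclideanSpace ℝ (Fin n) → Matrix (Fin n) (Fin n) ℝ)
    (y : EuclideanSpace ℝ (Fin n)) : ℝ :=
  ∑ j, ∑ k, (G y)⁻¹ j k * ricci G j k y

/-- The component `(𝓛_X g)ᵢⱼ = Xᵏ gᵢⱼ,ₖ + Xᵏ,ᵢ gₖⱼ + Xᵏ,ⱼ gᵢₖ` of the Lie derivative of `G = (gᵢⱼ)`
along `X = (Xᵏ)`. -/
def lieDerivMetric (X : EuclideanSpace ℝ (Fin n) → Fin n → ℝ)
    (G : EuclideanSpace ℝ (Fin n) → Matrix (Fin n) (Fin n) ℝ)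
    (i j : Fin n) (y : EuclideanSpace ℝ (Fin n)) : ℝ :=
  ∑ k, (X y k * pd k (fun z => G z i j) y
    + pd i (fun z => X z k) y * G y k j + pd j (fun z => X z k) y * G y i k)

/-- The total derivative `dF/dt = F,ₜ + F,ₖ ẏᵏ` of a function `F(t, y)`, a function of
`(t, y, ẏ)`; here `v = ẏ`. -/
def totalDeriv (F : ℝ → EuclideanSpace ℝ (Fin n) → ℝ)
    (t : ℝ) (y v : EuclideanSpace ℝ (Fin n)) : ℝ :=
  deriv (fun s => F s y) t + ∑ k, pd k (F t) y * v k

/-- The first prolongation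
`X^{[1]} = ξ ∂ₜ + ηⁱ ∂_{yⁱ} + (dηⁱ/dt - ẏⁱ dξ/dt) ∂_{ẏⁱ}` of `X = ξ(t,y) ∂ₜ + ηⁱ(t,y) ∂_{yⁱ}`
applied to a function `Λ(t, y, ẏ)`. -/
def prolongation (ξ : ℝ → EuclideanSpace ℝ (Fin n) → ℝ)
    (η : ℝ → EuclideanSpace ℝ (Fin n) → Fin n → ℝ)
    (Λ : ℝ → EuclideanSpace ℝ (Fin n) → EuclideanSpace ℝ (Fin n) → ℝ)
    (t : ℝ) (y v : EuclideanSpace ℝ (Fin n)) : ℝ :=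
  ξ t y * deriv (fun s => Λ s y v) t
    + ∑ i, η t y i * pd i (fun z => Λ t z v) y
    + ∑ i, (totalDeriv (fun s z => η s z i) t y v - v i * totalDeriv ξ t y v) * pd i (Λ t y) v

/-- The geodesic Lagrangian `½ gᵢⱼ(y) ẏⁱ ẏʲ`. -/
def lagrangian (G : EuclideanSpace ℝ (Fin n) → Matrix (Fin n) (Fin n) ℝ)
    (_t : ℝ) (y v : EuclideanSpace ℝ (Fin n)) : ℝ :=
  1 / 2 * ∑ i, ∑ j, G y i j * v i * v j

end Coordinates

/-! ### Manifolds -/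

section Manifolds

attribute [local instance 2000] chartedSpaceSelf

variable {n : ℕ} {M : Type*} [TopologicalSpace M] [ChartedSpace (EuclideanSpace ℝ (Fin n)) M]

variable (n M) in
/-- A smooth nondegenerate metric, of arbitrary signature, on the `n`-manifold `M`. -/
structure Metric [IsManifold (𝓡 n) ∞ M] where
  /-- The bilinear form on each tangent space. -/
  val (x : M) : TangentSpace (𝓡 n) x →L[ℝ] TangentSpace (𝓡 n) x →L[ℝ] ℝ
  symm (x : M) (v w : TangentSpace (𝓡 n) x) : val x v w = val x w v
  nondegenerate (x : M) (v : TangentSpace (𝓡 n) x) (h : ∀ w, val x v w = 0) : v = 0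
  contMDiff : ContMDiff (𝓡 n)
    ((𝓡 n).prod 𝓘(ℝ, EuclideanSpace ℝ (Fin n) →L[ℝ] EuclideanSpace ℝ (Fin n) →L[ℝ] ℝ)) ∞
    (fun x => Bundle.TotalSpace.mk'
      (EuclideanSpace ℝ (Fin n) →L[ℝ] EuclideanSpace ℝ (Fin n) →L[ℝ] ℝ)
      (E := fun x : M => TangentSpace (𝓡 n) x →L[ℝ] TangentSpace (𝓡 n) x →L[ℝ] ℝ) x (val x))

/-- The coordinate vector field `∂ᵢ` of the chart `e`, at the point with coordinates `y`. -/
def coordVec (e : OpenPartialHomeomorph M (EuclideanSpace ℝ (Fin n))) (i : Fin n)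
    (y : EuclideanSpace ℝ (Fin n)) : TangentSpace (𝓡 n) (e.symm y) :=
  mfderiv (𝓡 n) (𝓡 n) e.symm y
    (EuclideanSpace.single i (1 : ℝ) : EuclideanSpace ℝ (Fin n))

/-- The coordinates `Xⁱ` in the chart `e` of a vector field `X`, at the point with
coordinates `y`. -/
def comp (e : OpenPartialHomeomorph M (EuclideanSpace ℝ (Fin n)))
    (X : ∀ x : M, TangentSpace (𝓡 n) x) (y : EuclideanSpace ℝ (Fin n)) (i : Fin n) : ℝ :=
  (EuclideanSpace.proj i : EuclideanSpace ℝ (Fin n) →L[ℝ] ℝ)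
    (mfderiv (𝓡 n) (𝓡 n) e (e.symm y) (X (e.symm y)))

variable [IsManifold (𝓡 n) ∞ M]

/-- The matrix `gᵢⱼ = g(∂ᵢ, ∂ⱼ)` of the metric in the chart `e`. -/
def Metric.matrix (g : Metric n M) (e : OpenPartialHomeomorph M (EuclideanSpace ℝ (Fin n)))
    (y : EuclideanSpace ℝ (Fin n)) : Matrix (Fin n) (Fin n) ℝ :=
  Matrix.of fun i j => g.val (e.symm y) (coordVec e i y) (coordVec e j y)

/-- The curvature scalar of `g` as a function on `M`. It does not depend on the chart, so it is
computed at `x` in the preferred chart at `x`. -/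
def Metric.scalarCurvature (g : Metric n M) (x : M) : ℝ :=
  scalar (g.matrix (chartAt (EuclideanSpace ℝ (Fin n)) x))
    (chartAt (EuclideanSpace ℝ (Fin n)) x x)

/-- `(M, g)` is an Einstein space: `Rᵢⱼ = (R / n) gᵢⱼ` in every chart, with `R` the curvature
scalar (a function). -/
def Metric.IsEinstein (g : Metric n M) : Prop :=
  ∀ e ∈ IsManifold.maximalAtlas (𝓡 n) ∞ M, ∀ y ∈ e.target, ∀ i j : Fin n,
    ricci (g.matrix e) i j y = g.scalarCurvature (e.symm y) / n * g.matrix e y i j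

/-- `D` is a (smooth) Killing vector field: `𝓛_D g = 0` in every chart. -/
structure Metric.IsKilling (g : Metric n M) (D : ∀ x : M, TangentSpace (𝓡 n) x) : Prop where
  contMDiff : ContMDiff (𝓡 n) (𝓡 n).tangent ∞
    (fun x => (⟨x, D x⟩ : TangentBundle (𝓡 n) M))
  lie_eq_zero : ∀ e ∈ IsManifold.maximalAtlas (𝓡 n) ∞ M, ∀ y ∈ e.target, ∀ i j : Fin n,
    lieDerivMetric (comp e D) (g.matrix e) i j y = 0

/-- `D` is a gradient on the open set `U`: `Dᵢ = S,ᵢ` for a smooth function `S` on `U`. -/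
def Metric.IsGradientOn (g : Metric n M) (D : ∀ x : M, TangentSpace (𝓡 n) x) (U : Set M) : Prop :=
  ∃ S : M → ℝ, ContMDiffOn (𝓡 n) 𝓘(ℝ, ℝ) ∞ S U ∧
    ∀ x ∈ U, ∀ v : TangentSpace (𝓡 n) x, g.val x (D x) v = mfderiv (𝓡 n) 𝓘(ℝ, ℝ) S x v

/-- `D` is a non-gradient Killing vector field: it is Killing, and it is not, even locally, the
gradient of a function, except where it vanishes identically (the zero field is admitted). -/
structure Metric.IsNonGradientKilling (g : Metric n M) (D : ∀ x : M, TangentSpace (𝓡 n) x) :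
    Prop where
  isKilling : g.IsKilling D
  nonGradient : ∀ U : Set M, IsOpen U → g.IsGradientOn D U → ∀ x ∈ U, D x = 0

/-- `X = ξ(t,x) ∂ₜ + ηⁱ(t,x) ∂ᵢ` is a Noether symmetry of the geodesic Lagrangian
`Λ = ½ gᵢⱼ ẋⁱ ẋʲ` with gauge function `f(t,x)`: `ξ`, `η`, `f` are smooth on `ℝ × M` and
`X^{[1]} Λ + (dξ/dt) Λ = df/dt` holds identically in `(t, x, ẋ)`, in every chart. -/
structure Metric.IsNoetherWithGauge (g : Metric n M) (ξ : ℝ → M → ℝ)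
    (η : ℝ → ∀ x : M, TangentSpace (𝓡 n) x) (f : ℝ → M → ℝ) : Prop where
  contMDiff_xi : ContMDiff (𝓘(ℝ, ℝ).prod (𝓡 n)) 𝓘(ℝ, ℝ) ∞ (fun p : ℝ × M => ξ p.1 p.2)
  contMDiff_eta : ContMDiff (𝓘(ℝ, ℝ).prod (𝓡 n)) (𝓡 n).tangent ∞
    (fun p : ℝ × M => (⟨p.2, η p.1 p.2⟩ : TangentBundle (𝓡 n) M))
  contMDiff_gauge : ContMDiff (𝓘(ℝ, ℝ).prod (𝓡 n)) 𝓘(ℝ, ℝ) ∞ (fun p : ℝ × M => f p.1 p.2)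
  noether : ∀ e ∈ IsManifold.maximalAtlas (𝓡 n) ∞ M, ∀ t : ℝ, ∀ y ∈ e.target,
    ∀ v : EuclideanSpace ℝ (Fin n),
    prolongation (fun s z => ξ s (e.symm z)) (fun s => comp e (η s)) (lagrangian (g.matrix e)) t y v
      + totalDeriv (fun s z => ξ s (e.symm z)) t y v * lagrangian (g.matrix e) t y v
      = totalDeriv (fun s z => f s (e.symm z)) t y v

/-- `X = ξ ∂ₜ + ηⁱ ∂ᵢ` is a Noether symmetry of the geodesic Lagrangian: it is one for some
smooth gauge function. -/
def Metric.IsNoetherSymmetry (g : Metric n M) (ξ : ℝ → M → ℝ)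
    (η : ℝ → ∀ x : M, TangentSpace (𝓡 n) x) : Prop :=
  ∃ f : ℝ → M → ℝ, g.IsNoetherWithGauge ξ η f

end Manifolds

end Geodesic

end

/-! In coordinates the Noether condition is a polynomial of degree three in the velocity, and its
homogeneous parts give the determining equations (`noether_iff`). The cubic part makes $\xi$
independent of $x$; the quadratic part reads $\mathcal L_\eta g=\xi_t\,g$; the linear part says that
$\eta_t$ is the gradient of $f$; the constant part is $f_t=0$.

For $n>2$ the contracted Bianchi identity (`pd_einstein_factor`) makes $R$ constant; otherwise this
is assumed. At each time $\eta$ is then homothetic with the constant factor $\psi=\xi_t$ on a metric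
with $\mathrm{Ric}=cg$, $c=R/n\neq0$. The trace-adjusted tensor
$\nabla\eta-\frac{\psi}{2}\,\mathrm{id}$, with its lower index raised, is skew, and its divergence
is $c\,\eta$ by the contracted Ricci identity. A skew tensor has zero double divergence, so
$c\,\mathrm{div}\,\eta=c\,n\psi/2=0$ (`homothetic_factor`). Hence $\xi$ is constant and every
$\eta(t)$ is Killing.

Since $f$ does not depend on $t$, neither does $\eta_t$; so $\eta_t=\eta(1)-\eta(0)$ is both Killing
and a gradient. Its covariant derivative is skew and symmetric, hence zero, and the Ricci identity
leaves $c\,\eta_t=0$ (`eq_zero_of_gradient_killing`). So $\eta$ is independent of $t$ and $f$ is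
constant. The same lemma shows that on a proper Einstein space every Killing field is non-gradient
in the required sense. The converse substitutes into the determining equations with zero gauge.

Everything local is done with matrix-valued functions on open subsets of $\mathbb R^n$;
connectedness of $M$ turns vanishing derivatives into constants. -/

namespace Geodesic

/-! ### Rules for partial derivatives. -/

section Calculus

variable {n : ℕ} {U : Set (EuclideanSpace ℝ (Fin n))} {y : EuclideanSpace ℝ (Fin n)}
  {F H : EuclideanSpace ℝ (Fin n) → ℝ}

lemma _root_.ContDiffOn.differentiableAt_of_isOpen (hF : ContDiffOn ℝ ∞ F U) (hU : IsOpen U)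
    (hy : y ∈ U) : DifferentiableAt ℝ F y :=
  (hF.contDiffAt (hU.mem_nhds hy)).differentiableAt (by simp)

lemma pd_congr (i : Fin n) (hU : IsOpen U) (hy : y ∈ U) (h : ∀ z ∈ U, F z = H z) :
    pd i F y = pd i H y := by
  unfold pd
  rw [Filter.EventuallyEq.fderiv_eq (Filter.eventuallyEq_of_mem (hU.mem_nhds hy) h)]

lemma pd_eq_zero_of_const (i : Fin n) (hU : IsOpen U) (hy : y ∈ U) {c : ℝ}
    (h : ∀ z ∈ U, F z = c) : pd i F y = 0 := by
  rw [pd_congr i hU hy (H := fun _ => c) h]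
  simp [pd]

lemma pd_add (i : Fin n) (hF : DifferentiableAt ℝ F y) (hH : DifferentiableAt ℝ H y) :
    pd i (fun z => F z + H z) y = pd i F y + pd i H y := by
  simp [pd, fderiv_fun_add hF hH]

lemma pd_sub (i : Fin n) (hF : DifferentiableAt ℝ F y) (hH : DifferentiableAt ℝ H y) :
    pd i (fun z => F z - H z) y = pd i F y - pd i H y := by
  simp [pd, fderiv_fun_sub hF hH]

lemma pd_mul (i : Fin n) (hF : DifferentiableAt ℝ F y) (hH : DifferentiableAt ℝ H y) :
    pd i (fun z => F z * H z) y = pd i F y * H y + F y * pd i H y := by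
  simp [pd, fderiv_fun_mul hF hH]; ring

lemma pd_const_mul (i : Fin n) (c : ℝ) (hF : DifferentiableAt ℝ F y) :
    pd i (fun z => c * F z) y = c * pd i F y := by
  rw [pd_mul i (differentiableAt_const c) hF]; simp [pd]

lemma pd_mul_const (i : Fin n) (c : ℝ) (hF : DifferentiableAt ℝ F y) :
    pd i (fun z => F z * c) y = pd i F y * c := by
  rw [pd_mul i hF (differentiableAt_const c)]; simp [pd]

lemma pd_neg (i : Fin n) : pd i (fun z => -F z) y = -pd i F y := by
  simp [pd, fderiv_fun_neg]

lemma pd_sum {ι : Type*} (s : Finset ι) (i : Fin n) {F : ι → EuclideanSpace ℝ (Fin n) → ℝ}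
    (hF : ∀ a ∈ s, DifferentiableAt ℝ (F a) y) :
    pd i (fun z => ∑ a ∈ s, F a z) y = ∑ a ∈ s, pd i (F a) y := by
  simp [pd, fderiv_fun_sum hF]

lemma contDiffOn_pd (i : Fin n) (hU : IsOpen U) (hF : ContDiffOn ℝ ∞ F U) :
    ContDiffOn ℝ ∞ (pd i F) U :=
  (hF.fderiv_of_isOpen hU (by simp)).clm_apply contDiffOn_const

lemma pd_comm (i j : Fin n) (hU : IsOpen U) (hy : y ∈ U) (hF : ContDiffOn ℝ ∞ F U) :
    pd i (pd j F) y = pd j (pd i F) y := by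
  have hF2 := hF.contDiffAt (hU.mem_nhds hy)
  have hs : IsSymmSndFDerivAt ℝ F y := hF2.isSymmSndFDerivAt (by
    rw [minSmoothness_of_isRCLikeNormedField]
    exact WithTop.coe_le_coe.2 (le_top (a := (2 : ℕ∞))))
  have hd : DifferentiableAt ℝ (fderiv ℝ F) y :=
    ((hF2.fderiv_right (m := 1) (by norm_cast)).differentiableAt (by simp))
  have key : ∀ a b : Fin n, pd a (pd b F) y
      = fderiv ℝ (fderiv ℝ F) y (EuclideanSpace.single a 1) (EuclideanSpace.single b 1) := by
    intro a b
    unfold pd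
    rw [fderiv_clm_apply hd (by fun_prop)]
    simp
  rw [key, key]
  exact hs _ _

end Calculus

/-! ### Entrywise calculus of matrix-valued functions. -/

section MatrixCalculus

variable {n : ℕ} {U : Set (EuclideanSpace ℝ (Fin n))} {y : EuclideanSpace ℝ (Fin n)}
  {A B : EuclideanSpace ℝ (Fin n) → Matrix (Fin n) (Fin n) ℝ}

/-- Entrywise smoothness of a matrix-valued function on a set. -/
def SmoothMatrixOn (A : EuclideanSpace ℝ (Fin n) → Matrix (Fin n) (Fin n) ℝ)
    (U : Set (EuclideanSpace ℝ (Fin n))) : Prop :=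
  ∀ i j, ContDiffOn ℝ ∞ (fun z => A z i j) U

/-- The entrywise partial derivative of a matrix-valued function. -/
noncomputable def mpd (k : Fin n) (A : EuclideanSpace ℝ (Fin n) → Matrix (Fin n) (Fin n) ℝ)
    (y : EuclideanSpace ℝ (Fin n)) : Matrix (Fin n) (Fin n) ℝ :=
  Matrix.of fun i j => pd k (fun z => A z i j) y

@[simp] lemma mpd_apply (k i j : Fin n) : mpd k A y i j = pd k (fun z => A z i j) y := rfl

lemma SmoothMatrixOn.add (hA : SmoothMatrixOn A U) (hB : SmoothMatrixOn B U) :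
    SmoothMatrixOn (fun z => A z + B z) U := fun i j => (hA i j).add (hB i j)

lemma SmoothMatrixOn.sub (hA : SmoothMatrixOn A U) (hB : SmoothMatrixOn B U) :
    SmoothMatrixOn (fun z => A z - B z) U := fun i j => (hA i j).sub (hB i j)

lemma SmoothMatrixOn.transpose (hA : SmoothMatrixOn A U) :
    SmoothMatrixOn (fun z => (A z).transpose) U := fun i j => hA j i

lemma SmoothMatrixOn.smul (c : ℝ) (hA : SmoothMatrixOn A U) :
    SmoothMatrixOn (fun z => c • A z) U := fun i j => contDiffOn_const.mul (hA i j)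

lemma SmoothMatrixOn.mul (hA : SmoothMatrixOn A U) (hB : SmoothMatrixOn B U) :
    SmoothMatrixOn (fun z => A z * B z) U := fun i j => by
  simp only [Matrix.mul_apply]
  exact ContDiffOn.sum fun k _ => (hA i k).mul (hB k j)

lemma SmoothMatrixOn.mpd (k : Fin n) (hU : IsOpen U) (hA : SmoothMatrixOn A U) :
    SmoothMatrixOn (mpd k A) U := fun i j => contDiffOn_pd k hU (hA i j)

lemma SmoothMatrixOn.det (hA : SmoothMatrixOn A U) : ContDiffOn ℝ ∞ (fun z => (A z).det) U := by
  simp only [Matrix.det_apply']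
  exact ContDiffOn.sum fun σ _ => contDiffOn_const.mul (contDiffOn_prod fun i _ => hA _ _)

lemma SmoothMatrixOn.inv (hA : SmoothMatrixOn A U) (hd : ∀ z ∈ U, (A z).det ≠ 0) :
    SmoothMatrixOn (fun z => (A z)⁻¹) U := fun i j => by
  -- Cramer's rule: an entry of the inverse is a quotient of determinants of smooth matrices.
  have h : ∀ z, (A z)⁻¹ i j = ((A z).det)⁻¹ * ((A z).updateRow j (Pi.single i 1)).det := by
    intro z
    rw [Matrix.inv_def, Matrix.smul_apply, Matrix.adjugate_apply, Ring.inverse_eq_inv', smul_eq_mul]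
  simp only [h]
  refine (hA.det.inv hd).mul (SmoothMatrixOn.det fun a b => ?_)
  by_cases hab : a = j
  · subst hab; simp only [Matrix.updateRow_self]; exact contDiffOn_const
  · simp only [Matrix.updateRow_ne hab]; exact hA a b

lemma mpd_congr (k : Fin n) (hU : IsOpen U) (hy : y ∈ U) (h : ∀ z ∈ U, A z = B z) :
    mpd k A y = mpd k B y := by
  ext i j
  exact pd_congr k hU hy fun z hz => by rw [h z hz]

lemma mpd_add (k : Fin n) (hU : IsOpen U) (hy : y ∈ U) (hA : SmoothMatrixOn A U)
    (hB : SmoothMatrixOn B U) : mpd k (fun z => A z + B z) y = mpd k A y + mpd k B y := by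
  ext i j
  exact pd_add k ((hA i j).differentiableAt_of_isOpen hU hy)
    ((hB i j).differentiableAt_of_isOpen hU hy)

lemma mpd_sub (k : Fin n) (hU : IsOpen U) (hy : y ∈ U) (hA : SmoothMatrixOn A U)
    (hB : SmoothMatrixOn B U) : mpd k (fun z => A z - B z) y = mpd k A y - mpd k B y := by
  ext i j
  exact pd_sub k ((hA i j).differentiableAt_of_isOpen hU hy)
    ((hB i j).differentiableAt_of_isOpen hU hy)

lemma mpd_smul (k : Fin n) (c : ℝ) (hU : IsOpen U) (hy : y ∈ U) (hA : SmoothMatrixOn A U) :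
    mpd k (fun z => c • A z) y = c • mpd k A y := by
  ext i j
  exact pd_const_mul k c ((hA i j).differentiableAt_of_isOpen hU hy)

lemma mpd_mul (k : Fin n) (hU : IsOpen U) (hy : y ∈ U) (hA : SmoothMatrixOn A U)
    (hB : SmoothMatrixOn B U) :
    mpd k (fun z => A z * B z) y = mpd k A y * B y + A y * mpd k B y := by
  ext i j
  have hA' := fun a b => (hA a b).differentiableAt_of_isOpen hU hy
  have hB' := fun a b => (hB a b).differentiableAt_of_isOpen hU hy
  simp only [mpd_apply, Matrix.mul_apply, Matrix.add_apply]
  rw [pd_sum _ _ fun a _ => (hA' i a).fun_mul (hB' a j), ← Finset.sum_add_distrib]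
  exact Finset.sum_congr rfl fun a _ => pd_mul k (hA' i a) (hB' a j)

lemma mpd_transpose (k : Fin n) :
    mpd k (fun z => (A z).transpose) y = (mpd k A y).transpose := rfl

lemma mpd_comm (i j : Fin n) (hU : IsOpen U) (hy : y ∈ U) (hA : SmoothMatrixOn A U) :
    mpd i (mpd j A) y = mpd j (mpd i A) y := by
  ext a b
  exact pd_comm i j hU hy (hA a b)

lemma mpd_eq_zero_of_const (k : Fin n) (hU : IsOpen U) (hy : y ∈ U)
    {C : Matrix (Fin n) (Fin n) ℝ} (h : ∀ z ∈ U, A z = C) : mpd k A y = 0 := by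
  ext i j
  exact pd_eq_zero_of_const k hU hy fun z hz => by rw [h z hz]

end MatrixCalculus

/-! ### Levi-Civita connection and curvature in matrix form; Bianchi identities. -/

section Curvature

variable {n : ℕ} {U : Set (EuclideanSpace ℝ (Fin n))} {y : EuclideanSpace ℝ (Fin n)}
  {G : EuclideanSpace ℝ (Fin n) → Matrix (Fin n) (Fin n) ℝ}

/-- `G` is the matrix of a smooth nondegenerate metric on the open set `U`. -/
structure IsMetricOn (G : EuclideanSpace ℝ (Fin n) → Matrix (Fin n) (Fin n) ℝ)
    (U : Set (EuclideanSpace ℝ (Fin n))) : Prop where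
  isOpen : IsOpen U
  smooth : SmoothMatrixOn G U
  symm : ∀ y ∈ U, (G y).transpose = G y
  det_ne : ∀ y ∈ U, (G y).det ≠ 0

/-- The connection matrix `(Γⁱⱼₖ)ᵢⱼ`. -/
noncomputable def conn (G : EuclideanSpace ℝ (Fin n) → Matrix (Fin n) (Fin n) ℝ) (k : Fin n)
    (y : EuclideanSpace ℝ (Fin n)) : Matrix (Fin n) (Fin n) ℝ :=
  Matrix.of fun i j => christoffel G i j k y

/-- The curvature matrix `∂ᵢΓₖ - ∂ₖΓᵢ + [Γᵢ, Γₖ]`. -/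
noncomputable def curv (G : EuclideanSpace ℝ (Fin n) → Matrix (Fin n) (Fin n) ℝ) (i k : Fin n)
    (y : EuclideanSpace ℝ (Fin n)) : Matrix (Fin n) (Fin n) ℝ :=
  mpd i (conn G k) y - mpd k (conn G i) y + (conn G i y * conn G k y - conn G k y * conn G i y)

lemma conn_apply (i j k : Fin n) : conn G k y i j = christoffel G i j k y := rfl

namespace IsMetricOn

lemma mono (hG : IsMetricOn G U) {V : Set (EuclideanSpace ℝ (Fin n))} (hV : IsOpen V)
    (h : V ⊆ U) : IsMetricOn G V :=
  ⟨hV, fun i j => (hG.smooth i j).mono h, fun y hy => hG.symm y (h hy),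
    fun y hy => hG.det_ne y (h hy)⟩

lemma apply_comm (hG : IsMetricOn G U) (hy : y ∈ U) (i j : Fin n) : G y i j = G y j i :=
  (congrFun (congrFun (hG.symm y hy) i) j).symm

lemma pd_apply_comm (hG : IsMetricOn G U) (hy : y ∈ U) (k i j : Fin n) :
    pd k (fun z => G z i j) y = pd k (fun z => G z j i) y :=
  pd_congr k hG.isOpen hy fun _ hz => hG.apply_comm hz i j

lemma inv_smooth (hG : IsMetricOn G U) : SmoothMatrixOn (fun z => (G z)⁻¹) U :=
  hG.smooth.inv hG.det_ne

lemma mul_inv (hG : IsMetricOn G U) (hy : y ∈ U) : G y * (G y)⁻¹ = 1 :=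
  Matrix.mul_nonsing_inv _ (hG.det_ne y hy).isUnit

lemma inv_mul (hG : IsMetricOn G U) (hy : y ∈ U) : (G y)⁻¹ * G y = 1 :=
  Matrix.nonsing_inv_mul _ (hG.det_ne y hy).isUnit

lemma inv_transpose (hG : IsMetricOn G U) (hy : y ∈ U) : ((G y)⁻¹).transpose = (G y)⁻¹ := by
  rw [Matrix.transpose_nonsing_inv, hG.symm y hy]

lemma conn_smooth (hG : IsMetricOn G U) (k : Fin n) : SmoothMatrixOn (conn G k) U :=
  fun i j => by
    refine contDiffOn_const.mul (ContDiffOn.sum fun l _ => (hG.inv_smooth i l).mul ?_)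
    exact ((contDiffOn_pd _ hG.isOpen (hG.smooth _ _)).add
      (contDiffOn_pd _ hG.isOpen (hG.smooth _ _))).sub (contDiffOn_pd _ hG.isOpen (hG.smooth _ _))

lemma christoffel_comm (hG : IsMetricOn G U) (hy : y ∈ U) (i j k : Fin n) :
    christoffel G i j k y = christoffel G i k j y := by
  unfold christoffel
  congr 1
  refine Finset.sum_congr rfl fun l _ => ?_
  rw [hG.pd_apply_comm hy l j k]; ring

lemma conn_comm (hG : IsMetricOn G U) (hy : y ∈ U) (i j k : Fin n) :
    conn G k y i j = conn G j y i k := hG.christoffel_comm hy i j k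

/-- Lowering the index of the Christoffel symbols. -/
lemma mul_conn_apply (hG : IsMetricOn G U) (hy : y ∈ U) (l j k : Fin n) :
    (G y * conn G k y) l j = 1 / 2 *
      (pd k (fun z => G z l j) y + pd j (fun z => G z l k) y - pd l (fun z => G z j k) y) := by
  set v : Fin n → ℝ := fun l =>
    pd k (fun z => G z l j) y + pd j (fun z => G z l k) y - pd l (fun z => G z j k) y
  have h1 : (fun i => conn G k y i j) = (1 / 2 : ℝ) • ((G y)⁻¹.mulVec v) := by
    ext i
    simp [conn, christoffel, Matrix.mulVec, dotProduct, v]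
  have h2 : (G y * conn G k y) l j = (G y).mulVec (fun i => conn G k y i j) l := rfl
  rw [h2, h1, Matrix.mulVec_smul, Matrix.mulVec_mulVec, hG.mul_inv hy, Matrix.one_mulVec]
  rfl

/-- The connection is compatible with the metric. -/
lemma mpd_metric (hG : IsMetricOn G U) (hy : y ∈ U) (k : Fin n) :
    mpd k G y = G y * conn G k y + (conn G k y).transpose * G y := by
  have h : (conn G k y).transpose * G y = (G y * conn G k y).transpose := by
    rw [Matrix.transpose_mul, hG.symm y hy]
  rw [h]
  ext i j
  rw [Matrix.add_apply, Matrix.transpose_apply, hG.mul_conn_apply hy, hG.mul_conn_apply hy,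
    mpd_apply, hG.pd_apply_comm hy k j i, hG.pd_apply_comm hy i j k, hG.pd_apply_comm hy j i k]
  ring

/-- Differentiate $G^{-1}G=1$ and insert metric compatibility: the inverse metric is parallel. -/
lemma mpd_inv (hG : IsMetricOn G U) (hy : y ∈ U) (k : Fin n) :
    mpd k (fun z => (G z)⁻¹) y = -(conn G k y * (G y)⁻¹) - (G y)⁻¹ * (conn G k y).transpose := by
  have h0 : mpd k (fun z => (G z)⁻¹ * G z) y = 0 :=
    mpd_eq_zero_of_const k hG.isOpen hy fun z hz => hG.inv_mul hz
  rw [mpd_mul k hG.isOpen hy hG.inv_smooth hG.smooth, hG.mpd_metric hy] at h0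
  have h1 := congrArg (fun X => X * (G y)⁻¹) h0
  simp only [add_mul, mul_add, mul_assoc, hG.mul_inv hy, zero_mul, mul_one] at h1
  rw [← mul_assoc ((G y)⁻¹) (G y), hG.inv_mul hy, one_mul] at h1
  rw [eq_sub_iff_add_eq, eq_neg_iff_add_eq_zero, ← h1]
  abel

/-- Contracting the upper index with the first form index reproduces the coordinate formula, up to
the symmetry of the Christoffel symbols in the quadratic terms. -/
lemma ricci_eq_curv (hG : IsMetricOn G U) (hy : y ∈ U) (j k : Fin n) :
    ricci G j k y = ∑ p, curv G p k y p j := by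
  unfold ricci
  rw [← Finset.sum_add_distrib]
  refine Finset.sum_congr rfl fun p _ => ?_
  simp only [curv, Matrix.add_apply, Matrix.sub_apply, Matrix.mul_apply, mpd_apply, conn_apply,
    ← Finset.sum_sub_distrib]
  congr 1
  refine Finset.sum_congr rfl fun l _ => ?_
  rw [hG.christoffel_comm hy p p l, hG.christoffel_comm hy p k l]

lemma curv_swap (i k : Fin n) : curv G k i y = -curv G i k y := by
  unfold curv; abel

lemma curv_smooth (hG : IsMetricOn G U) (i k : Fin n) : SmoothMatrixOn (curv G i k) U :=
  (((hG.conn_smooth k).mpd i hG.isOpen).sub ((hG.conn_smooth i).mpd k hG.isOpen)).add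
    (((hG.conn_smooth i).mul (hG.conn_smooth k)).sub ((hG.conn_smooth k).mul (hG.conn_smooth i)))

/-- Covariant derivative of the curvature matrix. -/
lemma mpd_curv (hG : IsMetricOn G U) (hy : y ∈ U) (m i k : Fin n) :
    mpd m (curv G i k) y = mpd m (mpd i (conn G k)) y - mpd m (mpd k (conn G i)) y
      + ((mpd m (conn G i) y * conn G k y + conn G i y * mpd m (conn G k) y)
        - (mpd m (conn G k) y * conn G i y + conn G k y * mpd m (conn G i) y)) := by
  have hU := hG.isOpen
  have hi := hG.conn_smooth i
  have hk := hG.conn_smooth k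
  have h : curv G i k = fun z => (mpd i (conn G k) z - mpd k (conn G i) z)
      + (conn G i z * conn G k z - conn G k z * conn G i z) := rfl
  rw [h, mpd_add m hU hy ((hk.mpd i hU).sub (hi.mpd k hU)) ((hi.mul hk).sub (hk.mul hi)),
    mpd_sub m hU hy (hk.mpd i hU) (hi.mpd k hU), mpd_sub m hU hy (hi.mul hk) (hk.mul hi),
    mpd_mul m hU hy hi hk, mpd_mul m hU hy hk hi]

/-- The second Bianchi identity. -/
lemma bianchi (hG : IsMetricOn G U) (hy : y ∈ U) (m i k : Fin n) :
    (mpd m (curv G i k) y + (conn G m y * curv G i k y - curv G i k y * conn G m y))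
      + (mpd i (curv G k m) y + (conn G i y * curv G k m y - curv G k m y * conn G i y))
      + (mpd k (curv G m i) y + (conn G k y * curv G m i y - curv G m i y * conn G k y)) = 0 := by
  have hU := hG.isOpen
  -- Once the mixed second derivatives of the connection matrices are identified, all remaining
  -- terms cancel as an identity in a noncommutative ring.
  rw [hG.mpd_curv hy, hG.mpd_curv hy, hG.mpd_curv hy,
    mpd_comm m i hU hy (hG.conn_smooth k), mpd_comm m k hU hy (hG.conn_smooth i),
    mpd_comm k i hU hy (hG.conn_smooth m)]
  unfold curv
  noncomm_ring

/-- The curvature is skew for the metric. -/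
lemma metric_mul_curv (hG : IsMetricOn G U) (hy : y ∈ U) (i k : Fin n) :
    G y * curv G i k y + (curv G i k y).transpose * G y = 0 := by
  have hU := hG.isOpen
  have hc := hG.conn_smooth
  have key : ∀ a b : Fin n, mpd a (mpd b G) y =
      (G y * conn G a y + (conn G a y).transpose * G y) * conn G b y + G y * mpd a (conn G b) y
      + ((mpd a (conn G b) y).transpose * G y
        + (conn G b y).transpose * (G y * conn G a y + (conn G a y).transpose * G y)) := by
    intro a b
    rw [mpd_congr a hU hy (fun z hz => hG.mpd_metric hz b),
      mpd_add a hU hy (hG.smooth.mul (hc b)) ((hc b).transpose.mul hG.smooth),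
      mpd_mul a hU hy hG.smooth (hc b), mpd_mul a hU hy (hc b).transpose hG.smooth,
      hG.mpd_metric hy a, mpd_transpose]
  -- The commutator of second derivatives of the metric, written out by compatibility, is exactly
  -- the symmetrized lowered curvature.
  have h := mpd_comm i k hU hy hG.smooth
  rw [key, key, ← sub_eq_zero] at h
  rw [← h]
  simp only [curv, Matrix.transpose_add, Matrix.transpose_sub, Matrix.transpose_mul]
  noncomm_ring

/-- The curvature matrix with its second index raised is skew-symmetric. -/
lemma curv_mul_inv_transpose (hG : IsMetricOn G U) (hy : y ∈ U) (i k : Fin n) :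
    (curv G i k y * (G y)⁻¹).transpose = -(curv G i k y * (G y)⁻¹) := by
  rw [Matrix.transpose_mul, hG.inv_transpose hy, eq_neg_iff_add_eq_zero]
  have h := congrArg (fun X => (G y)⁻¹ * X * (G y)⁻¹) (hG.metric_mul_curv hy i k)
  simp only [mul_add, add_mul, mul_zero, zero_mul] at h
  rw [mul_assoc, mul_assoc, mul_assoc, mul_assoc, hG.mul_inv hy, mul_one, ← mul_assoc (_)⁻¹ (G y),
    hG.inv_mul hy, one_mul] at h
  rw [← h, add_comm]

/-- The second Bianchi identity for the curvature matrix with its second index raised. -/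
lemma bianchi_raised (hG : IsMetricOn G U) (hy : y ∈ U) (m i k : Fin n) :
    (mpd m (fun z => curv G i k z * (G z)⁻¹) y + (conn G m y * (curv G i k y * (G y)⁻¹)
        + curv G i k y * (G y)⁻¹ * (conn G m y).transpose))
      + (mpd i (fun z => curv G k m z * (G z)⁻¹) y + (conn G i y * (curv G k m y * (G y)⁻¹)
        + curv G k m y * (G y)⁻¹ * (conn G i y).transpose))
      + (mpd k (fun z => curv G m i z * (G z)⁻¹) y + (conn G k y * (curv G m i y * (G y)⁻¹)
        + curv G m i y * (G y)⁻¹ * (conn G k y).transpose)) = 0 := by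
  have hU := hG.isOpen
  have hc := hG.curv_smooth
  -- Parallelism of the inverse metric replaces the right half of each commutator by a transposed
  -- connection term, so this is the lower-index identity times $G^{-1}$.
  rw [mpd_mul _ hU hy (hc _ _) hG.inv_smooth, mpd_mul _ hU hy (hc _ _) hG.inv_smooth,
    mpd_mul _ hU hy (hc _ _) hG.inv_smooth, hG.mpd_inv hy, hG.mpd_inv hy, hG.mpd_inv hy]
  have h := congrArg (fun X => X * (G y)⁻¹) (hG.bianchi hy m i k)
  simp only [zero_mul] at h
  rw [← h]
  noncomm_ring

end IsMetricOn

end Curvature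

lemma sum_sum_eq_zero_of_antisymm {ι : Type*} [Fintype ι] {f : ι → ι → ℝ}
    (h : ∀ i j, f i j = -f j i) : ∑ i, ∑ j, f i j = 0 := by
  have h1 : ∑ i, ∑ j, f i j = -∑ i, ∑ j, f i j := by
    conv_lhs => rw [Finset.sum_comm]
    simp only [← Finset.sum_neg_distrib]
    exact Finset.sum_congr rfl fun i _ => Finset.sum_congr rfl fun j _ => h j i
  linarith

/-! ### Contracted Bianchi identity and Schur's argument. -/

section Einstein

variable {n : ℕ} {U : Set (EuclideanSpace ℝ (Fin n))} {y : EuclideanSpace ℝ (Fin n)}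
  {G : EuclideanSpace ℝ (Fin n) → Matrix (Fin n) (Fin n) ℝ} {c : EuclideanSpace ℝ (Fin n) → ℝ}

namespace IsMetricOn

/-- The contraction is the Ricci tensor with one index raised, which the Einstein condition turns
into $c\,\delta$. -/
lemma sum_curv_mul_inv (hG : IsMetricOn G U) (hy : y ∈ U)
    (hric : ∀ j k, ricci G j k y = c y * G y j k) (k j : Fin n) :
    ∑ i, (curv G i k y * (G y)⁻¹) i j = if k = j then c y else 0 := by
  simp only [Matrix.mul_apply]
  rw [Finset.sum_comm]
  simp only [← Finset.sum_mul, ← hG.ricci_eq_curv hy, hric]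
  have h := congrFun (congrFun (hG.mul_inv hy) k) j
  rw [Matrix.mul_apply, Matrix.one_apply] at h
  simp only [hG.apply_comm hy _ k, mul_assoc, ← Finset.mul_sum, h]
  simp

/-- The contracted Bianchi identity for a metric whose Ricci tensor is `c` times the metric. -/
lemma pd_einstein_factor (hG : IsMetricOn G U) (hc : ContDiffOn ℝ ∞ c U)
    (hric : ∀ z ∈ U, ∀ j k, ricci G j k z = c z * G z j k) (hy : y ∈ U) (m : Fin n) :
    ((n : ℝ) - 2) * pd m c y = 0 := by
  have hU := hG.isOpen
  set Q : Fin n → Fin n → EuclideanSpace ℝ (Fin n) → Matrix (Fin n) (Fin n) ℝ :=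
    fun i k z => curv G i k z * (G z)⁻¹ with hQ
  have hQs : ∀ i k, SmoothMatrixOn (Q i k) U := fun i k => (hG.curv_smooth i k).mul hG.inv_smooth
  have hQd : ∀ i k a b, DifferentiableAt ℝ (fun z => Q i k z a b) y := fun i k a b =>
    (hQs i k a b).differentiableAt_of_isOpen hU hy
  have hcd := hc.differentiableAt_of_isOpen hU hy
  have hskew : ∀ z ∈ U, ∀ i k a b, Q i k z a b = -Q i k z b a := fun z hz i k a b =>
    congrFun (congrFun (hG.curv_mul_inv_transpose hz i k) b) a
  have hswap : ∀ z, ∀ i k a b, Q i k z a b = -Q k i z a b := fun z i k a b => by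
    simp only [hQ]; rw [curv_swap k i, neg_mul]; rfl
  -- All four contractions of a form index of `Q` with a matrix index equal $\pm c\,\delta$; the
  -- signs come from the two skew symmetries of `Q`.
  have r1 : ∀ z ∈ U, ∀ k j, ∑ i, Q i k z i j = if k = j then c z else 0 := fun z hz k j =>
    hG.sum_curv_mul_inv hz (hric z hz) k j
  have r2 : ∀ z ∈ U, ∀ k j, ∑ i, Q i k z j i = if k = j then -c z else 0 := fun z hz k j => by
    rw [Finset.sum_congr rfl fun i _ => hskew z hz i k j i, Finset.sum_neg_distrib, r1 z hz]
    split_ifs <;> simp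
  have r3 : ∀ z ∈ U, ∀ k j, ∑ i, Q k i z i j = if k = j then -c z else 0 := fun z hz k j => by
    rw [Finset.sum_congr rfl fun i _ => hswap z k i i j, Finset.sum_neg_distrib, r1 z hz]
    split_ifs <;> simp
  have r4 : ∀ z ∈ U, ∀ k j, ∑ i, Q k i z j i = if k = j then c z else 0 := fun z hz k j => by
    rw [Finset.sum_congr rfl fun i _ => hswap z k i j i, Finset.sum_neg_distrib, r2 z hz]
    split_ifs <;> simp
  -- Taking the $(i,k)$ entry of the raised Bianchi identity and summing over both indices is the
  -- double contraction. The derivative terms `t1`, `t2`, `t3` give $n-1-1$ copies of $\partial_m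
  -- c$.
  have hB : ∑ i, ∑ k, _ = ∑ i : Fin n, ∑ k : Fin n, (0 : ℝ) :=
    Finset.sum_congr rfl fun i _ => Finset.sum_congr rfl fun k _ =>
      congrFun (congrFun (hG.bianchi_raised hy m i k) i) k
  have t1 : ∑ i, ∑ k, pd m (fun z => Q i k z i k) y = n * pd m c y := by
    have e : ∀ k, ∑ i, pd m (fun z => Q i k z i k) y = pd m c y := fun k => by
      rw [← pd_sum _ _ fun i _ => hQd i k i k]
      exact pd_congr m hU hy fun z hz => by rw [r1 z hz]; simp
    rw [Finset.sum_comm, Finset.sum_congr rfl fun k _ => e k]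
    simp
  have t2 : ∑ i, ∑ k, pd i (fun z => Q k m z i k) y = -pd m c y := by
    have e : ∀ i, ∑ k, pd i (fun z => Q k m z i k) y = if m = i then -pd i c y else 0 := fun i => by
      rw [← pd_sum _ _ fun k _ => hQd k m i k]
      rw [pd_congr i hU hy fun z hz => r2 z hz m i]
      split_ifs
      · exact pd_neg i
      · simp [pd]
    rw [Finset.sum_congr rfl fun k _ => e k]
    simp
  have t3 : ∑ i, ∑ k, pd k (fun z => Q m i z i k) y = -pd m c y := by
    have e : ∀ k, ∑ i, pd k (fun z => Q m i z i k) y = if m = k then -pd k c y else 0 := fun k => by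
      rw [← pd_sum _ _ fun i _ => hQd m i i k]
      rw [pd_congr k hU hy fun z hz => r3 z hz m k]
      split_ifs
      · exact pd_neg k
      · simp [pd]
    rw [Finset.sum_comm, Finset.sum_congr rfl fun k _ => e k]
    simp
  -- The connection terms contribute nothing: `s1`, `s2` cancel `s3`, `s4`, and `s5`, `s6` pair the
  -- skew `Q` with the symmetric Christoffel symbols.
  have s1 : ∑ i, ∑ k, ∑ l, conn G m y i l * Q i k y l k = c y * ∑ i, conn G m y i i := by
    have e : ∀ i, ∑ k, ∑ l, conn G m y i l * Q i k y l k = c y * conn G m y i i := fun i => by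
      rw [Finset.sum_comm]
      simp only [← Finset.mul_sum, r4 y hy]
      simp [mul_comm]
    rw [Finset.sum_congr rfl fun i _ => e i, Finset.mul_sum]
  have s2 : ∑ i, ∑ k, ∑ l, Q i k y i l * conn G m y k l = c y * ∑ i, conn G m y i i := by
    have e : ∀ k, ∑ i, ∑ l, Q i k y i l * conn G m y k l = c y * conn G m y k k := fun k => by
      rw [Finset.sum_comm]
      simp only [← Finset.sum_mul, r1 y hy]
      simp
    rw [Finset.sum_comm, Finset.sum_congr rfl fun i _ => e i, Finset.mul_sum]
  have s3 : ∑ i, ∑ k, ∑ l, conn G i y i l * Q k m y l k = -c y * ∑ i, conn G m y i i := by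
    have e : ∀ i, ∑ k, ∑ l, conn G i y i l * Q k m y l k = -c y * conn G m y i i := fun i => by
      rw [Finset.sum_comm]
      simp only [← Finset.mul_sum, r2 y hy]
      simp [mul_comm, hG.conn_comm hy i m i]
    rw [Finset.sum_congr rfl fun i _ => e i, Finset.mul_sum]
  have s4 : ∑ i, ∑ k, ∑ l, Q m i y i l * conn G k y k l = -c y * ∑ i, conn G m y i i := by
    have e : ∀ k, ∑ i, ∑ l, Q m i y i l * conn G k y k l = -c y * conn G m y k k := fun k => by
      rw [Finset.sum_comm]
      simp only [← Finset.sum_mul, r3 y hy]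
      simp [hG.conn_comm hy k m k]
    rw [Finset.sum_comm, Finset.sum_congr rfl fun i _ => e i, Finset.mul_sum]
  have s5 : ∑ i, ∑ k, ∑ l, Q k m y i l * conn G i y k l = 0 := by
    rw [Finset.sum_comm]
    exact Finset.sum_eq_zero fun k _ => sum_sum_eq_zero_of_antisymm fun i l => by
      rw [hskew y hy k m i l, hG.conn_comm hy k l i]; ring
  have s6 : ∑ i, ∑ k, ∑ l, conn G k y i l * Q m i y l k = 0 :=
    Finset.sum_eq_zero fun i _ => sum_sum_eq_zero_of_antisymm fun k l => by
      rw [hskew y hy m i l k, hG.conn_comm hy i l k]; ring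
  change ∑ i, ∑ k, ((pd m (fun z => Q i k z i k) y
      + ((conn G m y * Q i k y) i k + (Q i k y * (conn G m y).transpose) i k))
    + (pd i (fun z => Q k m z i k) y
      + ((conn G i y * Q k m y) i k + (Q k m y * (conn G i y).transpose) i k))
    + (pd k (fun z => Q m i z i k) y
      + ((conn G k y * Q m i y) i k + (Q m i y * (conn G k y).transpose) i k))) = _ at hB
  simp only [Matrix.mul_apply, Matrix.transpose_apply, Finset.sum_add_distrib, s1, s2, s3, s4, s5,
    s6, t1, t2, t3, Finset.sum_const_zero] at hB
  linarith

end IsMetricOn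

end Einstein

/-! ### Covariant derivative of a vector field and the contracted Ricci identity. -/

section CovariantDerivative

variable {n : ℕ} {U : Set (EuclideanSpace ℝ (Fin n))} {y : EuclideanSpace ℝ (Fin n)}
  {G : EuclideanSpace ℝ (Fin n) → Matrix (Fin n) (Fin n) ℝ}
  {η : EuclideanSpace ℝ (Fin n) → Fin n → ℝ}

/-- The matrix `(∇ⱼηⁱ)ᵢⱼ`. -/
noncomputable def covDeriv (G : EuclideanSpace ℝ (Fin n) → Matrix (Fin n) (Fin n) ℝ)
    (η : EuclideanSpace ℝ (Fin n) → Fin n → ℝ) (y : EuclideanSpace ℝ (Fin n)) :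
    Matrix (Fin n) (Fin n) ℝ :=
  Matrix.of fun i j => pd j (fun z => η z i) y + ∑ l, christoffel G i j l y * η y l

lemma covDeriv_apply (i j : Fin n) : covDeriv G η y i j
    = pd j (fun z => η z i) y + ∑ l, christoffel G i j l y * η y l := rfl

namespace IsMetricOn

lemma covDeriv_smooth (hG : IsMetricOn G U) (hη : ∀ i, ContDiffOn ℝ ∞ (fun z => η z i) U) :
    SmoothMatrixOn (covDeriv G η) U := fun i j =>
  (contDiffOn_pd j hG.isOpen (hη i)).add
    (ContDiffOn.sum fun l _ => (hG.conn_smooth l i j).mul (hη l))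

lemma metric_mul_covDeriv_apply (hG : IsMetricOn G U) (hy : y ∈ U) (i j : Fin n) :
    (G y * covDeriv G η y) i j = ∑ k, (G y i k * pd j (fun z => η z k) y
      + 1 / 2 * (pd k (fun z => G z i j) y + pd j (fun z => G z i k) y
        - pd i (fun z => G z j k) y) * η y k) := by
  simp only [Matrix.mul_apply, covDeriv_apply, mul_add, Finset.sum_add_distrib]
  congr 1
  simp only [Finset.mul_sum]
  rw [Finset.sum_comm]
  refine Finset.sum_congr rfl fun l _ => ?_
  rw [← hG.mul_conn_apply hy i j l, Matrix.mul_apply, Finset.sum_mul]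
  exact Finset.sum_congr rfl fun k _ => by rw [conn_apply]; ring

/-- This is $\nabla_j\eta_i+\nabla_i\eta_j=(\mathcal L_\eta g)_{ij}$: the Killing and homothety
equations become conditions on the symmetric part of the lowered covariant derivative. -/
lemma metric_mul_covDeriv_add_transpose (hG : IsMetricOn G U) (hy : y ∈ U) (i j : Fin n) :
    (G y * covDeriv G η y + (covDeriv G η y).transpose * G y) i j = lieDerivMetric η G i j y := by
  have h : (covDeriv G η y).transpose * G y = (G y * covDeriv G η y).transpose := by
    rw [Matrix.transpose_mul, hG.symm y hy]
  rw [h, Matrix.add_apply, Matrix.transpose_apply, hG.metric_mul_covDeriv_apply hy,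
    hG.metric_mul_covDeriv_apply hy, ← Finset.sum_add_distrib]
  unfold lieDerivMetric
  refine Finset.sum_congr rfl fun k _ => ?_
  rw [hG.apply_comm hy k j, hG.pd_apply_comm hy k j i]
  ring

/-- The contracted Ricci identity `∇ₖ∇ⱼηᵏ - ∇ⱼ∇ₖηᵏ = Rₗⱼηˡ`. -/
lemma contracted_ricci_identity (hG : IsMetricOn G U)
    (hη : ∀ i, ContDiffOn ℝ ∞ (fun z => η z i) U) (hy : y ∈ U) (j : Fin n) :
    ∑ k, (mpd k (covDeriv G η) y + conn G k y * covDeriv G η y - covDeriv G η y * conn G k y) k j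
      = pd j (fun z => (covDeriv G η z).trace) y + ∑ l, ricci G l j y * η y l := by
  have hU := hG.isOpen
  have hηd : ∀ i, DifferentiableAt ℝ (fun z => η z i) y := fun i =>
    (hη i).differentiableAt_of_isOpen hU hy
  have hηd2 : ∀ i k, DifferentiableAt ℝ (pd k fun z => η z i) y := fun i k =>
    (contDiffOn_pd k hU (hη i)).differentiableAt_of_isOpen hU hy
  have hΓd : ∀ i k l, DifferentiableAt ℝ (christoffel G i k l) y := fun i k l =>
    (hG.conn_smooth l i k).differentiableAt_of_isOpen hU hy
  have hAd : ∀ i k, DifferentiableAt ℝ (fun z => covDeriv G η z i k) y := fun i k =>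
    (hG.covDeriv_smooth hη i k).differentiableAt_of_isOpen hU hy
  have d : ∀ k a b, pd k (fun z => covDeriv G η z a b) y = pd k (pd b fun z => η z a) y
      + ∑ l, (pd k (christoffel G a b l) y * η y l
        + christoffel G a b l y * pd k (fun z => η z l) y) := by
    intro k a b
    simp only [covDeriv_apply]
    rw [pd_add k (hηd2 a b) (DifferentiableAt.fun_sum fun l _ => (hΓd a b l).fun_mul (hηd l)),
      pd_sum _ _ fun l _ => (hΓd a b l).fun_mul (hηd l)]
    congr 1
    exact Finset.sum_congr rfl fun l _ => pd_mul k (hΓd a b l) (hηd l)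
  have hsymd : ∀ k a b l, pd k (christoffel G a b l) y = pd k (christoffel G a l b) y :=
    fun k a b l => pd_congr k hU hy fun z hz => hG.christoffel_comm hz a b l
  have htr : pd j (fun z => (covDeriv G η z).trace) y
      = ∑ k, pd j (fun z => covDeriv G η z k k) y := pd_sum _ _ fun k _ => hAd k k
  rw [htr]
  simp only [Matrix.sub_apply, Matrix.add_apply, mpd_apply, d]
  simp only [Matrix.mul_apply, conn_apply, covDeriv_apply, Finset.sum_add_distrib,
    Finset.sum_sub_distrib, mul_add, add_mul, sub_mul,
    ricci, Finset.sum_mul, Finset.mul_sum]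
  -- Matching by order in $\eta$: second derivatives commute (`e0`), first-derivative terms cancel
  -- (`e1`, `e2`), and the undifferentiated terms assemble into Ricci (`e3` to `e6`).
  have e0 : ∑ k, pd k (pd j fun z => η z k) y = ∑ k, pd j (pd k fun z => η z k) y :=
    Finset.sum_congr rfl fun k _ => pd_comm k j hU hy (hη k)
  have e1 : ∑ k, ∑ l, christoffel G k j l y * pd k (fun z => η z l) y
      = ∑ k, ∑ l, pd l (fun z => η z k) y * christoffel G l j k y := by
    rw [Finset.sum_comm]
    exact Finset.sum_congr rfl fun k _ => Finset.sum_congr rfl fun l _ => mul_comm _ _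
  have e2 : ∑ k, ∑ l, christoffel G k l k y * pd j (fun z => η z l) y
      = ∑ k, ∑ l, christoffel G k k l y * pd j (fun z => η z l) y :=
    Finset.sum_congr rfl fun k _ => Finset.sum_congr rfl fun l _ => by
      rw [hG.christoffel_comm hy k l k]
  have e3 : ∑ k, ∑ l, pd k (christoffel G k j l) y * η y l
      = ∑ l, ∑ k, pd k (christoffel G k l j) y * η y l := by
    rw [Finset.sum_comm]
    exact Finset.sum_congr rfl fun k _ => Finset.sum_congr rfl fun l _ => by rw [hsymd]
  have e4 : ∑ k, ∑ l, pd j (christoffel G k k l) y * η y l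
      = ∑ l, ∑ k, pd j (christoffel G k l k) y * η y l := by
    rw [Finset.sum_comm]
    exact Finset.sum_congr rfl fun k _ => Finset.sum_congr rfl fun l _ => by rw [hsymd]
  have e5 : ∑ k, ∑ l, ∑ m, christoffel G k l k y * (christoffel G l j m y * η y m)
      = ∑ m, ∑ k, ∑ l, christoffel G k k l y * christoffel G l m j y * η y m := by
    rw [Finset.sum_congr rfl fun k _ => Finset.sum_comm, Finset.sum_comm]
    exact Finset.sum_congr rfl fun m _ => Finset.sum_congr rfl fun k _ =>
      Finset.sum_congr rfl fun l _ => by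
        rw [hG.christoffel_comm hy k l k, hG.christoffel_comm hy l j m]; ring
  have e6 : ∑ k, ∑ l, ∑ m, christoffel G k l m y * η y m * christoffel G l j k y
      = ∑ m, ∑ k, ∑ l, christoffel G k j l y * christoffel G l m k y * η y m := by
    rw [Finset.sum_congr rfl fun k _ => Finset.sum_comm, Finset.sum_comm]
    refine Finset.sum_congr rfl fun m _ => ?_
    rw [Finset.sum_comm]
    exact Finset.sum_congr rfl fun k _ =>
      Finset.sum_congr rfl fun l _ => by
        rw [hG.christoffel_comm hy l k m]; ring
  linarith

end IsMetricOn

end CovariantDerivative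

/-! ### Rigidity of gradient Killing fields and of homotheties. -/

section KillingAndHomothetic

variable {n : ℕ} {U : Set (EuclideanSpace ℝ (Fin n))} {y : EuclideanSpace ℝ (Fin n)}
  {G : EuclideanSpace ℝ (Fin n) → Matrix (Fin n) (Fin n) ℝ}
  {η : EuclideanSpace ℝ (Fin n) → Fin n → ℝ}

namespace IsMetricOn

lemma eq_zero_of_mulVec_eq_zero (hG : IsMetricOn G U) (hy : y ∈ U) {v : Fin n → ℝ}
    (h : (G y).mulVec v = 0) : v = 0 := by
  rw [← Matrix.one_mulVec v, ← hG.inv_mul hy, ← Matrix.mulVec_mulVec, h, Matrix.mulVec_zero]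

/-- Lower the index of $\nabla\eta$: equality of mixed second derivatives of $S$ makes it symmetric,
the Killing equation makes it skew. -/
lemma covDeriv_eq_zero_of_gradient_killing (hG : IsMetricOn G U)
    (hη : ∀ i, ContDiffOn ℝ ∞ (fun z => η z i) U)
    (hK : ∀ z ∈ U, ∀ i j, lieDerivMetric η G i j z = 0)
    {S : EuclideanSpace ℝ (Fin n) → ℝ} (hS : ContDiffOn ℝ ∞ S U)
    (hgrad : ∀ z ∈ U, ∀ i, ∑ k, G z i k * η z k = pd i S z) (hy : y ∈ U) :
    covDeriv G η y = 0 := by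
  have hU := hG.isOpen
  have hηd : ∀ i, DifferentiableAt ℝ (fun z => η z i) y := fun i =>
    (hη i).differentiableAt_of_isOpen hU hy
  have hGd : ∀ i k, DifferentiableAt ℝ (fun z => G z i k) y := fun i k =>
    (hG.smooth i k).differentiableAt_of_isOpen hU hy
  have hess : ∀ i j, pd j (pd i S) y = ∑ k, (pd j (fun z => G z i k) y * η y k
      + G y i k * pd j (fun z => η z k) y) := by
    intro i j
    rw [← pd_congr j hU hy fun z hz => hgrad z hz i,
      pd_sum _ _ fun k _ => (hGd i k).fun_mul (hηd k)]
    exact Finset.sum_congr rfl fun k _ => pd_mul j (hGd i k) (hηd k)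
  have hsymm : ∀ i j, (G y * covDeriv G η y) i j = (G y * covDeriv G η y) j i := by
    intro i j
    have h := pd_comm j i hU hy hS
    rw [hess, hess, ← sub_eq_zero, ← Finset.sum_sub_distrib] at h
    rw [hG.metric_mul_covDeriv_apply hy, hG.metric_mul_covDeriv_apply hy, ← sub_eq_zero,
      ← Finset.sum_sub_distrib, ← h]
    refine Finset.sum_congr rfl fun k _ => ?_
    rw [hG.pd_apply_comm hy k j i]
    ring
  have hzero : G y * covDeriv G η y = 0 := by
    ext i j
    have h := hG.metric_mul_covDeriv_add_transpose (η := η) hy i j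
    have ht : (covDeriv G η y).transpose * G y = (G y * covDeriv G η y).transpose := by
      rw [Matrix.transpose_mul, hG.symm y hy]
    rw [hK y hy, ht, Matrix.add_apply, Matrix.transpose_apply, ← hsymm i j] at h
    simp only [Matrix.zero_apply]
    linarith
  rw [← one_mul (covDeriv G η y), ← hG.inv_mul hy, mul_assoc, hzero, mul_zero]

/-- A gradient Killing field of a metric with `Ric = c g`, `c ≠ 0`, vanishes. -/
lemma eq_zero_of_gradient_killing (hG : IsMetricOn G U)
    (hη : ∀ i, ContDiffOn ℝ ∞ (fun z => η z i) U)
    (hK : ∀ z ∈ U, ∀ i j, lieDerivMetric η G i j z = 0)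
    {S : EuclideanSpace ℝ (Fin n) → ℝ} (hS : ContDiffOn ℝ ∞ S U)
    (hgrad : ∀ z ∈ U, ∀ i, ∑ k, G z i k * η z k = pd i S z) (hy : y ∈ U)
    {c : ℝ} (hc : c ≠ 0) (hric : ∀ j k, ricci G j k y = c * G y j k) : η y = 0 := by
  have hU := hG.isOpen
  have hA : ∀ z ∈ U, covDeriv G η z = 0 := fun z hz =>
    hG.covDeriv_eq_zero_of_gradient_killing hη hK hS hgrad hz
  refine hG.eq_zero_of_mulVec_eq_zero hy (funext fun j => ?_)
  -- For a parallel field every derivative term of the Ricci identity vanishes, leaving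
  -- $R_{lj}\eta^l=0$.
  have h := hG.contracted_ricci_identity hη hy j
  rw [pd_eq_zero_of_const (c := 0) j hU hy fun z hz => by rw [hA z hz, Matrix.trace_zero]] at h
  simp only [mpd_eq_zero_of_const _ hU hy hA, hA y hy, mul_zero, zero_mul, add_zero, sub_zero,
    Matrix.zero_apply, Finset.sum_const_zero, zero_add, hric, mul_assoc, ← Finset.mul_sum] at h
  have h2 := (mul_eq_zero.1 h.symm).resolve_left hc
  rw [Pi.zero_apply, ← h2]
  change ∑ k, G y j k * η y k = _
  exact Finset.sum_congr rfl fun k _ => by rw [hG.apply_comm hy j k]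

/-- The trace of the connection matrices is closed. -/
lemma pd_trace_conn_comm (hG : IsMetricOn G U) (hy : y ∈ U) (j k : Fin n) :
    pd j (fun z => (conn G k z).trace) y = pd k (fun z => (conn G j z).trace) y := by
  have hU := hG.isOpen
  -- A matrix that is skew for the metric is traceless; in the trace of the curvature the commutator
  -- drops out, leaving the curl of the connection traces.
  have h : (curv G j k y).trace = 0 := by
    have h1 := congrArg (fun X => ((G y)⁻¹ * X).trace) (hG.metric_mul_curv hy j k)
    simp only [mul_add, mul_zero, Matrix.trace_add, Matrix.trace_zero] at h1
    rw [← mul_assoc, hG.inv_mul hy, one_mul, Matrix.trace_mul_comm, mul_assoc, hG.mul_inv hy,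
      mul_one, Matrix.trace_transpose] at h1
    linarith
  have e : ∀ a b, pd a (fun z => (conn G b z).trace) y = (mpd a (conn G b) y).trace :=
    fun a b => pd_sum _ _ fun i _ => (hG.conn_smooth b i i).differentiableAt_of_isOpen hU hy
  rw [e, e]
  rw [curv, Matrix.trace_add, Matrix.trace_sub, Matrix.trace_sub,
    Matrix.trace_mul_comm (conn G k y)] at h
  linarith

/-- The covariant double divergence of a skew-symmetric tensor field vanishes. -/
lemma double_divergence_skew (hG : IsMetricOn G U)
    {W : EuclideanSpace ℝ (Fin n) → Matrix (Fin n) (Fin n) ℝ} (hW : SmoothMatrixOn W U)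
    (hskew : ∀ z ∈ U, ∀ i j, W z i j = -W z j i) {V : EuclideanSpace ℝ (Fin n) → Fin n → ℝ}
    (hV : ∀ z ∈ U, ∀ j, ∑ k, (pd k (fun z => W z k j) z + (conn G k z).trace * W z k j) = V z j)
    (hy : y ∈ U) :
    ∑ j, (pd j (fun z => V z j) y + (conn G j y).trace * V y j) = 0 := by
  have hU := hG.isOpen
  have hWd : ∀ i j, DifferentiableAt ℝ (fun z => W z i j) y := fun i j =>
    (hW i j).differentiableAt_of_isOpen hU hy
  have hWd2 : ∀ k i j, DifferentiableAt ℝ (pd k fun z => W z i j) y := fun k i j =>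
    (contDiffOn_pd k hU (hW i j)).differentiableAt_of_isOpen hU hy
  have hτ : ∀ k, DifferentiableAt ℝ (fun z => (conn G k z).trace) y := fun k =>
    (ContDiffOn.sum fun i _ => hG.conn_smooth k i i :
      ContDiffOn ℝ ∞ (fun z => ∑ i, conn G k z i i) U).differentiableAt_of_isOpen hU hy
  have hskewd : ∀ k i j, pd k (fun z => W z i j) y = -pd k (fun z => W z j i) y := fun k i j => by
    rw [pd_congr k hU hy fun z hz => hskew z hz i j, pd_neg]
  have h1 : ∀ j, pd j (fun z => V z j) y = ∑ k, (pd j (pd k fun z => W z k j) y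
      + (pd j (fun z => (conn G k z).trace) y * W y k j
        + (conn G k y).trace * pd j (fun z => W z k j) y)) := by
    intro j
    rw [← pd_congr j hU hy fun z hz => hV z hz j,
      pd_sum _ _ fun k _ => (hWd2 k k j).fun_add ((hτ k).fun_mul (hWd k j))]
    refine Finset.sum_congr rfl fun k _ => ?_
    rw [pd_add j (hWd2 k k j) ((hτ k).fun_mul (hWd k j)), pd_mul j (hτ k) (hWd k j)]
  -- Skewness of `W` meets three symmetric objects: mixed partials, the closed one-form of
  -- connection traces, and its square. The two cross terms cancel each other by `s4`.
  have s1 : ∑ j, ∑ k, pd j (pd k fun z => W z k j) y = 0 :=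
    sum_sum_eq_zero_of_antisymm fun j k => by
      rw [pd_comm j k hU hy (hW k j), ← pd_neg]
      exact pd_congr k hU hy fun z hz => by
        rw [pd_congr j hU hz fun w hw => hskew w hw k j, pd_neg]
  have s2 : ∑ j, ∑ k, pd j (fun z => (conn G k z).trace) y * W y k j = 0 :=
    sum_sum_eq_zero_of_antisymm fun j k => by
      rw [hG.pd_trace_conn_comm hy j k, hskew y hy k j]; ring
  have s3 : ∑ j, ∑ k, (conn G j y).trace * ((conn G k y).trace * W y k j) = 0 :=
    sum_sum_eq_zero_of_antisymm fun j k => by rw [hskew y hy k j]; ring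
  have s4 : ∑ j, ∑ k, (conn G k y).trace * pd j (fun z => W z k j) y
      = -∑ j, ∑ k, (conn G j y).trace * pd k (fun z => W z k j) y := by
    rw [Finset.sum_comm]
    simp only [← Finset.sum_neg_distrib]
    exact Finset.sum_congr rfl fun k _ => Finset.sum_congr rfl fun j _ => by
      rw [hskewd j k j]; ring
  simp only [h1, ← hV y hy, Finset.mul_sum, mul_add, Finset.sum_add_distrib, s1, s2, s3, s4]
  ring

/-- A homothetic field of a metric with `Ric = c g`, `c` constant, satisfies `c ψ n = 0`. -/
lemma homothetic_factor (hG : IsMetricOn G U)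
    (hη : ∀ i, ContDiffOn ℝ ∞ (fun z => η z i) U) {ψ c : ℝ}
    (hL : ∀ z ∈ U, ∀ i j, lieDerivMetric η G i j z = ψ * G z i j)
    (hric : ∀ z ∈ U, ∀ j k, ricci G j k z = c * G z j k) (hy : y ∈ U) : c * (ψ * n) = 0 := by
  have hU := hG.isOpen
  have hA := hG.covDeriv_smooth hη
  have hGA : ∀ z ∈ U, G z * covDeriv G η z + (covDeriv G η z).transpose * G z = ψ • G z := by
    intro z hz
    ext i j
    rw [hG.metric_mul_covDeriv_add_transpose hz, hL z hz]
    rfl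
  have hAP : ∀ z ∈ U, covDeriv G η z * (G z)⁻¹ + (G z)⁻¹ * (covDeriv G η z).transpose
      = ψ • (G z)⁻¹ := by
    intro z hz
    have h := congrArg (fun X => (G z)⁻¹ * X * (G z)⁻¹) (hGA z hz)
    simp only [mul_add, add_mul, Matrix.mul_smul, Matrix.smul_mul] at h
    rw [hG.inv_mul hz, one_mul, ← mul_assoc, hG.inv_mul hz, one_mul, mul_assoc (_)⁻¹,
      mul_assoc _ (G z), hG.mul_inv hz, mul_one] at h
    exact h
  have htr : ∀ z ∈ U, (covDeriv G η z).trace = ψ * n / 2 := by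
    intro z hz
    have h := congrArg (fun X => ((G z)⁻¹ * X).trace) (hGA z hz)
    simp only [mul_add, Matrix.trace_add, Matrix.mul_smul, Matrix.trace_smul] at h
    rw [← mul_assoc, hG.inv_mul hz, one_mul, Matrix.trace_mul_comm, mul_assoc, hG.mul_inv hz,
      mul_one, Matrix.trace_transpose, Matrix.trace_one, Fintype.card_fin, smul_eq_mul] at h
    linarith
  -- By the homothety equation the symmetric part of the raised covariant derivative is
  -- $\frac{\psi}{2}g^{-1}$, so `W` is its skew part.
  set W : EuclideanSpace ℝ (Fin n) → Matrix (Fin n) (Fin n) ℝ :=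
    fun z => covDeriv G η z * (G z)⁻¹ - (ψ / 2) • (G z)⁻¹ with hWdef
  have hWs : SmoothMatrixOn W U := (hA.mul hG.inv_smooth).sub (hG.inv_smooth.smul _)
  have hWt : ∀ z ∈ U, (W z).transpose = -W z := by
    intro z hz
    simp only [hWdef, Matrix.transpose_sub, Matrix.transpose_mul, Matrix.transpose_smul,
      hG.inv_transpose hz]
    have h := hAP z hz
    rw [← eq_sub_iff_add_eq'] at h
    rw [h]
    have : (ψ / 2) • (G z)⁻¹ + (ψ / 2) • (G z)⁻¹ = ψ • (G z)⁻¹ := by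
      rw [← add_smul, add_halves]
    rw [← this]
    abel
  have hskew : ∀ z ∈ U, ∀ i j, W z i j = -W z j i := fun z hz i j =>
    congrFun (congrFun (hWt z hz) j) i
  -- The inverse metric is parallel and $\psi$ constant, so the subtracted term does not affect the
  -- covariant derivative.
  have hDW : ∀ z ∈ U, ∀ k, mpd k W z + conn G k z * W z + W z * (conn G k z).transpose
      = (mpd k (covDeriv G η) z + conn G k z * covDeriv G η z - covDeriv G η z * conn G k z)
        * (G z)⁻¹ := by
    intro z hz k
    simp only [hWdef]
    rw [mpd_sub k hU hz (hA.mul hG.inv_smooth) (hG.inv_smooth.smul _),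
      mpd_mul k hU hz hA hG.inv_smooth, mpd_smul k _ hU hz hG.inv_smooth, hG.mpd_inv hz]
    simp only [mul_sub, sub_mul, add_mul, smul_sub, smul_neg, mul_neg, Matrix.mul_smul,
      Matrix.smul_mul, mul_assoc]
    abel
  -- The trace of $\nabla\eta$ is constant, so the contracted Ricci identity gives the divergence of
  -- `W` as the Ricci tensor applied to $\eta$. The connection term on the free index drops by
  -- skewness (`h4`).
  have hdiv : ∀ z ∈ U, ∀ j,
      ∑ k, (pd k (fun z => W z k j) z + (conn G k z).trace * W z k j) = c * η z j := by
    intro z hz j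
    have h1 : ∑ k, (mpd k W z + conn G k z * W z + W z * (conn G k z).transpose) k j
        = c * η z j := by
      rw [Finset.sum_congr rfl fun k _ => congrFun (congrFun (hDW z hz k) k) j]
      simp only [Matrix.mul_apply (N := (G z)⁻¹)]
      rw [Finset.sum_comm]
      simp only [← Finset.sum_mul]
      rw [Finset.sum_congr rfl fun l _ => by
        rw [hG.contracted_ricci_identity hη hz l, pd_eq_zero_of_const l hU hz htr, zero_add]]
      simp only [hric z hz, Finset.sum_mul]
      rw [Finset.sum_comm]
      have h2 : ∀ m, ∑ l, G z m l * (G z)⁻¹ l j = if m = j then 1 else 0 := fun m => by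
        rw [← Matrix.mul_apply, hG.mul_inv hz, Matrix.one_apply]
      have h3 : ∀ m, ∑ l, c * G z m l * η z m * (G z)⁻¹ l j
          = c * η z m * (if m = j then 1 else 0) := fun m => by
        rw [← h2, Finset.mul_sum]
        exact Finset.sum_congr rfl fun l _ => by ring
      simp [h3]
    have h4 : ∑ k, (W z * (conn G k z).transpose) k j = 0 := by
      simp only [Matrix.mul_apply, Matrix.transpose_apply]
      exact sum_sum_eq_zero_of_antisymm fun k l => by
        rw [hskew z hz k l, hG.conn_comm hz j l k]; ring
    have h5 : ∑ k, (conn G k z * W z) k j = ∑ k, (conn G k z).trace * W z k j := by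
      simp only [Matrix.mul_apply, Matrix.trace, Matrix.diag_apply, Finset.sum_mul]
      rw [Finset.sum_comm]
      exact Finset.sum_congr rfl fun k _ => Finset.sum_congr rfl fun l _ => by
        rw [hG.conn_comm hz l k l]
    simp only [Matrix.add_apply, Finset.sum_add_distrib, h4, h5, mpd_apply, add_zero] at h1
    rw [Finset.sum_add_distrib, h1]
  have h := hG.double_divergence_skew hWs hskew hdiv hy
  -- The double divergence of `W` is $c$ times the divergence of $\eta$, already known to be $\psi
  -- n/2$.
  have h6 : ∑ j, (pd j (fun z => c * η z j) y + (conn G j y).trace * (c * η y j))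
      = c * (covDeriv G η y).trace := by
    simp only [Matrix.trace, Matrix.diag_apply, covDeriv_apply, Finset.sum_add_distrib, mul_add]
    congr 1
    · rw [Finset.mul_sum]
      exact Finset.sum_congr rfl fun j _ =>
        pd_const_mul j c ((hη j).differentiableAt_of_isOpen hU hy)
    · simp only [Finset.mul_sum, Finset.sum_mul]
      rw [Finset.sum_comm]
      exact Finset.sum_congr rfl fun k _ => Finset.sum_congr rfl fun l _ => by
        rw [conn_apply]; ring
  rw [h6, htr y hy] at h
  linarith

end IsMetricOn

end KillingAndHomothetic

/-! ### Linear and quadratic forms that vanish identically. -/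

section QuadraticForms

open Matrix

variable {ι : Type*} [Fintype ι] [DecidableEq ι]

/-- Polarization on the standard basis vectors. -/
lemma eq_zero_of_forall_dotProduct_mulVec {H : Matrix ι ι ℝ} (hs : H.transpose = H)
    (h : ∀ v : ι → ℝ, v ⬝ᵥ H *ᵥ v = 0) : H = 0 := by
  ext i j
  have h1 := h (Pi.single i 1)
  have h2 := h (Pi.single j 1)
  have h3 := h (Pi.single i 1 + Pi.single j 1)
  have hij : H j i = H i j := congrFun (congrFun hs i) j
  simp only [Matrix.mulVec_add, add_dotProduct, dotProduct_add, Matrix.mulVec_single_one,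
    single_one_dotProduct, Matrix.col_apply] at h1 h2 h3
  simp only [Matrix.zero_apply]
  linarith

/-- The form may be indefinite, so null vectors have to be handled. If $m\cdot w=1$, then $w$ and
$w\pm u$ are null for every $u\in\ker m$; hence $w$ is orthogonal to $\ker m$ and to itself, and
nondegeneracy forces $w=0$. -/
lemma eq_zero_of_forall_dotProduct_mul {G : Matrix ι ι ℝ} (hs : G.transpose = G) (hd : G.det ≠ 0)
    {m : ι → ℝ} (h : ∀ v : ι → ℝ, (m ⬝ᵥ v) * (v ⬝ᵥ G *ᵥ v) = 0) : m = 0 := by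
  by_contra hm
  have hw : ∃ w, m ⬝ᵥ w = 1 := by
    have hmm : m ⬝ᵥ m ≠ 0 := fun h0 => hm (dotProduct_self_eq_zero.1 h0)
    exact ⟨(m ⬝ᵥ m)⁻¹ • m, by rw [dotProduct_smul, smul_eq_mul, inv_mul_cancel₀ hmm]⟩
  obtain ⟨w, hw⟩ := hw
  have hsym : ∀ u v, u ⬝ᵥ G *ᵥ v = v ⬝ᵥ G *ᵥ u := by
    intro u v
    rw [dotProduct_mulVec, ← Matrix.mulVec_transpose, hs, dotProduct_comm]
  have h0 : w ⬝ᵥ G *ᵥ w = 0 := by have := h w; rwa [hw, one_mul] at this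
  have hk : ∀ u, m ⬝ᵥ u = 0 → u ⬝ᵥ G *ᵥ w = 0 := by
    intro u hu
    have h1 := h (w + u)
    have h2 := h (w - u)
    simp only [dotProduct_add, dotProduct_sub, hw, hu, add_zero, sub_zero, one_mul,
      Matrix.mulVec_add, Matrix.mulVec_sub, add_dotProduct, sub_dotProduct, hsym w u] at h1 h2
    linarith
  have hall : ∀ u, u ⬝ᵥ G *ᵥ w = 0 := by
    intro u
    have h1 := hk (u - (m ⬝ᵥ u) • w)
      (by rw [dotProduct_sub, dotProduct_smul, hw, smul_eq_mul, mul_one, sub_self])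
    rwa [sub_dotProduct, smul_dotProduct, h0, smul_zero, sub_zero] at h1
  have hGw : G *ᵥ w = 0 := dotProduct_self_eq_zero.1 (hall _)
  have hw0 : w = 0 := Matrix.eq_zero_of_mulVec_eq_zero hd hGw
  rw [hw0, dotProduct_zero] at hw
  exact zero_ne_one hw

end QuadraticForms

/-! ### The Noether condition as a polynomial in the velocity. -/

section Noether

variable {n : ℕ} {U : Set (EuclideanSpace ℝ (Fin n))} {y : EuclideanSpace ℝ (Fin n)}
  {G : EuclideanSpace ℝ (Fin n) → Matrix (Fin n) (Fin n) ℝ}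
  {ξ f : ℝ → EuclideanSpace ℝ (Fin n) → ℝ} {η : ℝ → EuclideanSpace ℝ (Fin n) → Fin n → ℝ}

lemma pd_coord (i a : Fin n) (v : EuclideanSpace ℝ (Fin n)) :
    pd i (fun z : EuclideanSpace ℝ (Fin n) => z a) v = if a = i then 1 else 0 := by
  have h : (fun z : EuclideanSpace ℝ (Fin n) => z a) = (EuclideanSpace.proj a :
      EuclideanSpace ℝ (Fin n) →L[ℝ] ℝ) := rfl
  unfold pd
  rw [h, ContinuousLinearMap.fderiv]
  simp

lemma lagrangian_eq (t : ℝ) (v : EuclideanSpace ℝ (Fin n)) :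
    lagrangian G t y v = 1 / 2 * (v.ofLp ⬝ᵥ (G y).mulVec v.ofLp) := by
  unfold lagrangian
  simp only [dotProduct, Matrix.mulVec, Finset.mul_sum]
  exact Finset.sum_congr rfl fun i _ => Finset.sum_congr rfl fun j _ => by ring

namespace IsMetricOn

lemma pd_lagrangian_velocity (hG : IsMetricOn G U) (hy : y ∈ U) (t : ℝ)
    (v : EuclideanSpace ℝ (Fin n)) (i : Fin n) :
    pd i (lagrangian G t y) v = ∑ j, G y i j * v j := by
  have hd : ∀ a, DifferentiableAt ℝ (fun z : EuclideanSpace ℝ (Fin n) => z a) v := fun a =>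
    (EuclideanSpace.proj a : EuclideanSpace ℝ (Fin n) →L[ℝ] ℝ).differentiableAt
  have hd2 : ∀ a b, DifferentiableAt ℝ
      (fun z : EuclideanSpace ℝ (Fin n) => G y a b * z a * z b) v := fun a b =>
    ((differentiableAt_const _).fun_mul (hd a)).fun_mul (hd b)
  have h1 : pd i (lagrangian G t y) v = 1 / 2 * ∑ a, ∑ b,
      (G y a b * (if a = i then 1 else 0) * v b + G y a b * v a * (if b = i then 1 else 0)) := by
    unfold lagrangian
    rw [pd_const_mul _ _ (DifferentiableAt.fun_sum fun a _ =>
      DifferentiableAt.fun_sum fun b _ => hd2 a b),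
      pd_sum _ _ fun a _ => DifferentiableAt.fun_sum fun b _ => hd2 a b]
    congr 1
    refine Finset.sum_congr rfl fun a _ => ?_
    rw [pd_sum _ _ fun b _ => hd2 a b]
    refine Finset.sum_congr rfl fun b _ => ?_
    rw [pd_mul i ((differentiableAt_const _).fun_mul (hd a)) (hd b), pd_const_mul i _ (hd a),
      pd_coord, pd_coord]
  rw [h1]
  simp only [Finset.sum_add_distrib]
  rw [Finset.sum_comm (f := fun a b => G y a b * (if a = i then 1 else 0) * v b)]
  simp only [mul_ite, mul_one, mul_zero, ite_mul, zero_mul, Finset.sum_ite_eq', Finset.mem_univ,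
    if_true]
  simp only [hG.apply_comm hy _ i]
  ring

lemma pd_lagrangian_position (hG : IsMetricOn G U) (hy : y ∈ U) (t : ℝ)
    (v : EuclideanSpace ℝ (Fin n)) (i : Fin n) :
    pd i (fun z => lagrangian G t z v) y
      = 1 / 2 * ∑ a, ∑ b, pd i (fun z => G z a b) y * v a * v b := by
  have hd : ∀ a b, DifferentiableAt ℝ (fun z => G z a b) y := fun a b =>
    (hG.smooth a b).differentiableAt_of_isOpen hG.isOpen hy
  have hd2 : ∀ a b, DifferentiableAt ℝ (fun z => G z a b * v a * v b) y := fun a b =>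
    ((hd a b).mul_const _).mul_const _
  unfold lagrangian
  rw [pd_const_mul _ _ (DifferentiableAt.fun_sum fun a _ =>
      DifferentiableAt.fun_sum fun b _ => hd2 a b),
    pd_sum _ _ fun a _ => DifferentiableAt.fun_sum fun b _ => hd2 a b]
  congr 1
  refine Finset.sum_congr rfl fun a _ => ?_
  rw [pd_sum _ _ fun b _ => hd2 a b]
  refine Finset.sum_congr rfl fun b _ => ?_
  rw [pd_mul_const i _ ((hd a b).mul_const _), pd_mul_const i _ (hd a b)]

/-- The left-hand side of the Noether condition, sorted by powers of the velocity. -/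
lemma noether_expansion (hG : IsMetricOn G U) (hy : y ∈ U) (t : ℝ)
    (v : EuclideanSpace ℝ (Fin n)) :
    prolongation ξ η (lagrangian G) t y v + totalDeriv ξ t y v * lagrangian G t y v
      = 1 / 2 * ∑ i, ∑ j, (lieDerivMetric (η t) G i j y - deriv (fun s => ξ s y) t * G y i j)
          * v i * v j
        + ∑ j, (∑ i, G y j i * deriv (fun s => η s y i) t) * v j
        - (∑ k, pd k (ξ t) y * v k) * lagrangian G t y v := by
  have hq : ∑ i, ∑ j, G y i j * v i * v j = 2 * lagrangian G t y v := by
    unfold lagrangian; ring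
  have hlt : deriv (fun s => lagrangian G s y v) t = 0 := by
    unfold lagrangian; simp
  unfold prolongation
  simp only [hG.pd_lagrangian_velocity hy, hG.pd_lagrangian_position hy, hlt, totalDeriv,
    lieDerivMetric]
  set L := lagrangian G t y v
  set T := deriv (fun s => ξ s y) t
  set m := ∑ k, pd k (ξ t) y * v k
  have a1 : ∑ i, η t y i * (1 / 2 * ∑ a, ∑ b, pd i (fun z => G z a b) y * v a * v b)
      = 1 / 2 * ∑ i, ∑ j, ∑ k, η t y k * pd k (fun z => G z i j) y * v i * v j := by
    simp only [Finset.mul_sum]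
    rw [Finset.sum_comm]
    refine Finset.sum_congr rfl fun i _ => ?_
    rw [Finset.sum_comm]
    exact Finset.sum_congr rfl fun j _ => Finset.sum_congr rfl fun k _ => by ring
  -- By homogeneity the prolongation contributes $-2\frac{d\xi}{dt}\Lambda$ here, so with the extra
  -- $+\frac{d\xi}{dt}\Lambda$ one negative copy remains; `T` feeds its quadratic part and `m` its
  -- cubic part.
  have a2 : ∑ i, v i * (T + m) * ∑ j, G y i j * v j = (T + m) * (2 * L) := by
    rw [← hq]
    simp only [Finset.mul_sum]
    exact Finset.sum_congr rfl fun i _ => Finset.sum_congr rfl fun j _ => by ring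
  have a3 : ∑ i, deriv (fun s => η s y i) t * ∑ j, G y i j * v j
      = ∑ j, (∑ i, G y j i * deriv (fun s => η s y i) t) * v j := by
    simp only [Finset.mul_sum, Finset.sum_mul]
    rw [Finset.sum_comm]
    exact Finset.sum_congr rfl fun i _ => Finset.sum_congr rfl fun j _ => by
      rw [hG.apply_comm hy i j]; ring
  have a4 : ∑ i, (∑ k, pd k (fun z => η t z i) y * v k) * ∑ j, G y i j * v j
      = ∑ i, ∑ j, ∑ k, pd j (fun z => η t z k) y * G y i k * v i * v j := by
    simp only [Finset.mul_sum, Finset.sum_mul]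
    rw [Finset.sum_comm]
    refine Finset.sum_congr rfl fun i _ => ?_
    rw [Finset.sum_comm]
    exact Finset.sum_congr rfl fun j _ => Finset.sum_congr rfl fun k _ => by
      rw [hG.apply_comm hy i k]; ring
  have a5 : ∑ i, ∑ j, ∑ k, pd i (fun z => η t z k) y * G y k j * v i * v j
      = ∑ i, ∑ j, ∑ k, pd j (fun z => η t z k) y * G y i k * v i * v j := by
    rw [Finset.sum_comm]
    exact Finset.sum_congr rfl fun i _ => Finset.sum_congr rfl fun j _ =>
      Finset.sum_congr rfl fun k _ => by rw [hG.apply_comm hy i k]; ring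
  have a6 : ∑ i, ∑ j, T * G y i j * v i * v j = T * (2 * L) := by
    rw [← hq]
    simp only [Finset.mul_sum, mul_assoc]
  simp only [Finset.sum_add_distrib, add_mul, sub_mul, Finset.sum_sub_distrib, Finset.sum_mul]
    at a2 a6 a1 a3 a4 a5 ⊢
  linarith

/-- The determining equations of the Noether symmetries of the geodesic Lagrangian. -/
lemma noether_iff (hG : IsMetricOn G U) (hy : y ∈ U) (t : ℝ) :
    (∀ v : EuclideanSpace ℝ (Fin n),
      prolongation ξ η (lagrangian G) t y v + totalDeriv ξ t y v * lagrangian G t y v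
        = totalDeriv f t y v) ↔
    (∀ k, pd k (ξ t) y = 0) ∧
      (∀ i j, lieDerivMetric (η t) G i j y = deriv (fun s => ξ s y) t * G y i j) ∧
      (∀ j, ∑ i, G y j i * deriv (fun s => η s y i) t = pd j (f t) y) ∧
      deriv (fun s => f s y) t = 0 := by
  simp only [hG.noether_expansion hy]
  simp only [totalDeriv]
  constructor
  · intro h
    set H : Matrix (Fin n) (Fin n) ℝ := Matrix.of fun i j =>
      lieDerivMetric (η t) G i j y - deriv (fun s => ξ s y) t * G y i j with hH
    set l : Fin n → ℝ := fun j => ∑ i, G y j i * deriv (fun s => η s y i) t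
    set b : Fin n → ℝ := fun j => pd j (f t) y
    set m : Fin n → ℝ := fun j => pd j (ξ t) y
    have h' : ∀ w : Fin n → ℝ, 1 / 2 * (w ⬝ᵥ H.mulVec w) + l ⬝ᵥ w
        - m ⬝ᵥ w * (1 / 2 * (w ⬝ᵥ (G y).mulVec w)) = deriv (fun s => f s y) t + b ⬝ᵥ w := by
      intro w
      have h1 := h (WithLp.toLp 2 w)
      rw [lagrangian_eq] at h1
      rw [← show ∑ i, ∑ j, H i j * w i * w j = w ⬝ᵥ H.mulVec w by
        simp only [dotProduct, Matrix.mulVec, Finset.mul_sum]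
        exact Finset.sum_congr rfl fun i _ => Finset.sum_congr rfl fun j _ => by ring]
      exact h1
    have hc : ∀ w : Fin n → ℝ, deriv (fun s => f s y) t = 0 ∧ w ⬝ᵥ H.mulVec w = 0 ∧
        (l - b) ⬝ᵥ w = 0 ∧ m ⬝ᵥ w * (w ⬝ᵥ (G y).mulVec w) = 0 := by
      intro w
      -- Rescaling the velocity gives a cubic polynomial in $s$; its values at $0,1,-1,2$ determine
      -- all four coefficients.
      have hs : ∀ s : ℝ, _ := fun s => h' (s • w)
      simp only [dotProduct_smul, smul_dotProduct, Matrix.mulVec_smul, smul_eq_mul] at hs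
      have h0 := hs 0
      have h1 := hs 1
      have h2 := hs (-1)
      have h3 := hs 2
      rw [sub_dotProduct]
      refine ⟨by linarith, by linarith, by linarith, by linarith⟩
    have hHt : H.transpose = H := by
      ext i j
      simp only [hH, Matrix.transpose_apply, Matrix.of_apply, hG.apply_comm hy j i]
      rw [← hG.metric_mul_covDeriv_add_transpose hy, ← hG.metric_mul_covDeriv_add_transpose hy]
      congr 1
      rw [← Matrix.transpose_apply (_ + _) i j, Matrix.transpose_add, Matrix.transpose_mul,
        Matrix.transpose_mul, Matrix.transpose_transpose, hG.symm y hy, add_comm]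
    have hH0 := eq_zero_of_forall_dotProduct_mulVec hHt fun w => (hc w).2.1
    have hm0 := eq_zero_of_forall_dotProduct_mul (hG.symm y hy) (hG.det_ne y hy)
      fun w => (hc w).2.2.2
    have hl0 : l - b = 0 := dotProduct_self_eq_zero.1 (hc (l - b)).2.2.1
    exact ⟨fun k => congrFun hm0 k, fun i j => sub_eq_zero.1 (congrFun (congrFun hH0 i) j),
      fun j => sub_eq_zero.1 (congrFun hl0 j), (hc 0).1⟩
  · rintro ⟨h1, h2, h3, h4⟩ v
    simp [h1, h2, h3, h4]

end IsMetricOn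

end Noether

/-! ### Passage from the manifold to charts. -/

section Charts

variable {n : ℕ} {M : Type*} [TopologicalSpace M] [ChartedSpace (EuclideanSpace ℝ (Fin n)) M]
  {e : OpenPartialHomeomorph M (EuclideanSpace ℝ (Fin n))}
  {y : EuclideanSpace ℝ (Fin n)}

lemma mdifferentiable_of_mem_maximalAtlas (he : e ∈ IsManifold.maximalAtlas (𝓡 n) ∞ M) :
    e.MDifferentiable (𝓡 n) (𝓡 n) :=
  ⟨(contMDiffOn_of_mem_maximalAtlas he).mdifferentiableOn (by simp),
    (contMDiffOn_symm_of_mem_maximalAtlas he).mdifferentiableOn (by simp)⟩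

lemma mfderiv_mfderiv_symm (he : e ∈ IsManifold.maximalAtlas (𝓡 n) ∞ M) (hy : y ∈ e.target)
    (v : EuclideanSpace ℝ (Fin n)) :
    mfderiv (𝓡 n) (𝓡 n) e (e.symm y) (mfderiv (𝓡 n) (𝓡 n) e.symm y v) = v :=
  congrArg (fun T => T v) ((mdifferentiable_of_mem_maximalAtlas he).comp_symm_deriv hy)

lemma mfderiv_symm_mfderiv (he : e ∈ IsManifold.maximalAtlas (𝓡 n) ∞ M) (hy : y ∈ e.target)
    (v : TangentSpace (𝓡 n) (e.symm y)) :
    mfderiv (𝓡 n) (𝓡 n) e.symm y (mfderiv (𝓡 n) (𝓡 n) e (e.symm y) v) = v := by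
  obtain ⟨w, rfl⟩ := (mdifferentiable_of_mem_maximalAtlas he).symm.mfderiv_surjective hy v
  exact congrArg (mfderiv (𝓡 n) (𝓡 n) e.symm y) (mfderiv_mfderiv_symm he hy w)

lemma mfderiv_symm_eq_sum (w : EuclideanSpace ℝ (Fin n)) :
    mfderiv (𝓡 n) (𝓡 n) e.symm y w = ∑ i, w i • coordVec e i y := by
  have h : w = ∑ i, w i • (EuclideanSpace.single i (1 : ℝ) : EuclideanSpace ℝ (Fin n)) := by
    have := (EuclideanSpace.basisFun (Fin n) ℝ).sum_repr w
    simpa using this.symm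
  set T : EuclideanSpace ℝ (Fin n) →L[ℝ] TangentSpace (𝓡 n) (e.symm y) :=
    mfderiv (𝓡 n) (𝓡 n) e.symm y
  change T w = ∑ i, w i • T (EuclideanSpace.single i (1 : ℝ))
  conv_lhs => rw [h]
  simp only [map_sum, map_smul]

lemma contDiffOn_family {ξ : ℝ → M → ℝ}
    (hξ : ContMDiff (𝓘(ℝ, ℝ).prod (𝓡 n)) 𝓘(ℝ, ℝ) ∞ (fun p : ℝ × M => ξ p.1 p.2))
    (he : e ∈ IsManifold.maximalAtlas (𝓡 n) ∞ M) :
    ContDiffOn ℝ ∞ (fun p : ℝ × EuclideanSpace ℝ (Fin n) => ξ p.1 (e.symm p.2))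
      (Set.univ ×ˢ e.target) := by
  have hp : ContMDiffOn 𝓘(ℝ, ℝ × EuclideanSpace ℝ (Fin n)) (𝓘(ℝ, ℝ).prod (𝓡 n)) ∞
      (fun p : ℝ × EuclideanSpace ℝ (Fin n) => ((p.1, e.symm p.2) : ℝ × M))
      (Set.univ ×ˢ e.target) := by
    refine ContMDiffOn.prodMk (contDiff_fst.contMDiff.contMDiffOn) ?_
    exact (contMDiffOn_symm_of_mem_maximalAtlas he).comp contDiff_snd.contMDiff.contMDiffOn
      fun p hp => hp.2
  exact contMDiffOn_iff_contDiffOn.1 (hξ.comp_contMDiffOn hp)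

lemma sum_comp_smul_coordVec (he : e ∈ IsManifold.maximalAtlas (𝓡 n) ∞ M) (hy : y ∈ e.target)
    (X : ∀ x : M, TangentSpace (𝓡 n) x) :
    X (e.symm y) = ∑ i, comp e X y i • coordVec e i y := by
  conv_lhs => rw [← mfderiv_symm_mfderiv he hy (X (e.symm y))]
  exact mfderiv_symm_eq_sum _

lemma eq_of_comp_eq (he : e ∈ IsManifold.maximalAtlas (𝓡 n) ∞ M) (hy : y ∈ e.target)
    {X Y : ∀ x : M, TangentSpace (𝓡 n) x} (h : ∀ i, comp e X y i = comp e Y y i) :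
    X (e.symm y) = Y (e.symm y) := by
  rw [sum_comp_smul_coordVec he hy X, sum_comp_smul_coordVec he hy Y]
  simp only [h]

variable [IsManifold (𝓡 n) ∞ M]

lemma val_eq_sum (g : Metric n M) (he : e ∈ IsManifold.maximalAtlas (𝓡 n) ∞ M)
    (hy : y ∈ e.target) (X : ∀ x : M, TangentSpace (𝓡 n) x) (j : Fin n) :
    g.val (e.symm y) (X (e.symm y)) (coordVec e j y) = ∑ i, g.matrix e y i j * comp e X y i := by
  conv_lhs => rw [sum_comp_smul_coordVec he hy X]
  simp only [map_sum, map_smul, _root_.sum_apply, _root_.smul_apply,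
    smul_eq_mul, Metric.matrix, Matrix.of_apply, mul_comm]

/-- The coordinate field is the image of a constant section under the tangent map of the inverse
chart. -/
lemma contMDiffOn_coordVec (he : e ∈ IsManifold.maximalAtlas (𝓡 n) ∞ M) (i : Fin n) :
    ContMDiffOn (𝓡 n) (𝓡 n).tangent ∞
      (fun y => (⟨e.symm y, coordVec e i y⟩ : TangentBundle (𝓡 n) M)) e.target := by
  have hT := (contMDiffOn_symm_of_mem_maximalAtlas he).contMDiffOn_tangentMapWithin
    (m := ∞) (by simp) e.open_target.uniqueMDiffOn
  have hs : ContMDiffOn (𝓡 n) (𝓡 n).tangent ∞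
      (fun y => (⟨y, EuclideanSpace.single i (1 : ℝ)⟩ :
        TangentBundle (𝓡 n) (EuclideanSpace ℝ (Fin n)))) e.target :=
    contMDiffOn_vectorSpace_iff_contDiffOn.2 contDiffOn_const
  refine (hT.comp hs fun y hy => hy).congr fun y hy => ?_
  simp only [Function.comp, tangentMapWithin, coordVec,
    mfderivWithin_of_isOpen e.open_target hy]

lemma smoothMatrixOn_matrix (g : Metric n M) (he : e ∈ IsManifold.maximalAtlas (𝓡 n) ∞ M) :
    SmoothMatrixOn (g.matrix e) e.target := by
  intro i j
  rw [← contMDiffOn_iff_contDiffOn]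
  have h : ContMDiffOn (𝓡 n) ((𝓡 n).prod 𝓘(ℝ, ℝ)) ∞
      (fun y => Bundle.TotalSpace.mk' ℝ (E := Bundle.Trivial M ℝ) (e.symm y)
        (g.val (e.symm y) (coordVec e i y) (coordVec e j y))) e.target := by
    apply ContMDiffOn.clm_bundle_apply₂ (F₁ := EuclideanSpace ℝ (Fin n))
      (F₂ := EuclideanSpace ℝ (Fin n))
    · exact g.contMDiff.comp_contMDiffOn (contMDiffOn_symm_of_mem_maximalAtlas he)
    · exact contMDiffOn_coordVec he i
    · exact contMDiffOn_coordVec he j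
  intro y hy
  have hy' := h y hy
  simp only [Bundle.contMDiffWithinAt_totalSpace] at hy'
  exact hy'.2

/-- This makes the whole coordinate theory available in any chart. A kernel vector of the matrix
would be a tangent vector orthogonal to every coordinate vector, hence to everything. -/
lemma isMetricOn_matrix (g : Metric n M) (he : e ∈ IsManifold.maximalAtlas (𝓡 n) ∞ M) :
    IsMetricOn (g.matrix e) e.target where
  isOpen := e.open_target
  smooth := smoothMatrixOn_matrix g he
  symm y _ := by
    ext i j
    exact g.symm _ _ _
  det_ne y hy h0 := by
    obtain ⟨v, hv, hv0⟩ := Matrix.exists_mulVec_eq_zero_iff.2 h0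
    set w : TangentSpace (𝓡 n) (e.symm y) := ∑ i, v i • coordVec e i y
    have hw : w = mfderiv (𝓡 n) (𝓡 n) e.symm y (WithLp.toLp 2 v : EuclideanSpace ℝ (Fin n)) :=
      (mfderiv_symm_eq_sum (e := e) (y := y) (WithLp.toLp 2 v)).symm
    have hj : ∀ j, g.val (e.symm y) w (coordVec e j y) = 0 := by
      intro j
      have := congrFun hv0 j
      rw [g.symm]
      simp only [w, map_sum, map_smul, smul_eq_mul]
      refine Eq.trans ?_ this
      exact Finset.sum_congr rfl fun i _ => mul_comm _ _
    have hw0 : w = 0 := by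
      refine g.nondegenerate _ w fun u => ?_
      obtain ⟨u, rfl⟩ := (mdifferentiable_of_mem_maximalAtlas he).symm.mfderiv_surjective hy u
      rw [show mfderiv (𝓡 n) (𝓡 n) e.symm y u = _ from mfderiv_symm_eq_sum u]
      simp only [map_sum, map_smul, hj, smul_zero, Finset.sum_const_zero]
    have h1 := mfderiv_mfderiv_symm he hy (WithLp.toLp 2 v)
    rw [← hw, hw0, map_zero] at h1
    exact hv (congrArg WithLp.ofLp h1).symm

/-- Smoothness of the coordinates of a smooth family of vector fields. -/
lemma contDiffOn_comp_family {η : ℝ → ∀ x : M, TangentSpace (𝓡 n) x}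
    (hη : ContMDiff (𝓘(ℝ, ℝ).prod (𝓡 n)) (𝓡 n).tangent ∞
      (fun p : ℝ × M => (⟨p.2, η p.1 p.2⟩ : TangentBundle (𝓡 n) M)))
    (he : e ∈ IsManifold.maximalAtlas (𝓡 n) ∞ M) (i : Fin n) :
    ContDiffOn ℝ ∞ (fun p : ℝ × EuclideanSpace ℝ (Fin n) => comp e (η p.1) p.2 i)
      (Set.univ ×ˢ e.target) := by
  have hT := (contMDiffOn_of_mem_maximalAtlas he).contMDiffOn_tangentMapWithin
    (m := ∞) (by simp) e.open_source.uniqueMDiffOn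
  have hp : ContMDiffOn 𝓘(ℝ, ℝ × EuclideanSpace ℝ (Fin n)) (𝓘(ℝ, ℝ).prod (𝓡 n)) ∞
      (fun p : ℝ × EuclideanSpace ℝ (Fin n) => ((p.1, e.symm p.2) : ℝ × M))
      (Set.univ ×ˢ e.target) := by
    refine ContMDiffOn.prodMk (contDiff_fst.contMDiff.contMDiffOn) ?_
    exact (contMDiffOn_symm_of_mem_maximalAtlas he).comp contDiff_snd.contMDiff.contMDiffOn
      fun p hp => hp.2
  have h1 := hT.comp (hη.comp_contMDiffOn hp) fun p hp => e.map_target hp.2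
  have h2 := (contMDiff_snd_tangentBundle_modelSpace (EuclideanSpace ℝ (Fin n))
    (𝓡 n) (n := ∞)).comp_contMDiffOn h1
  have h3 := (contMDiffOn_iff_contDiffOn.1 h2)
  refine ((EuclideanSpace.proj i : EuclideanSpace ℝ (Fin n) →L[ℝ] ℝ).contDiff.comp_contDiffOn
    h3).congr fun p hp => ?_
  simp only [Function.comp, tangentMapWithin, comp,
    mfderivWithin_of_isOpen e.open_source (e.map_target hp.2)]

end Charts

/-! ### Auxiliary facts in one chart. -/

section LocalCalculus

variable {n : ℕ} {U : Set (EuclideanSpace ℝ (Fin n))} {y : EuclideanSpace ℝ (Fin n)}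
  {G : EuclideanSpace ℝ (Fin n) → Matrix (Fin n) (Fin n) ℝ}

lemma fderiv_eq_zero_of_pd_eq_zero {F : EuclideanSpace ℝ (Fin n) → ℝ}
    (h : ∀ i, pd i F y = 0) : fderiv ℝ F y = 0 := by
  ext w
  have hw : w = ∑ i, w i • (EuclideanSpace.single i (1 : ℝ) : EuclideanSpace ℝ (Fin n)) := by
    simpa using ((EuclideanSpace.basisFun (Fin n) ℝ).sum_repr w).symm
  rw [hw, map_sum]
  exact Finset.sum_eq_zero fun i _ => by
    rw [map_smul, show fderiv ℝ F y (EuclideanSpace.single i 1) = 0 from h i, smul_zero]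

lemma sub_eq_of_forall_deriv_eq {φ : ℝ → ℝ} (hφ : Differentiable ℝ φ) {d : ℝ}
    (h : ∀ s, deriv φ s = d) (a b : ℝ) : φ b - φ a = d * (b - a) := by
  have h1 := is_const_of_deriv_eq_zero (f := fun s => φ s - d * s) (by fun_prop) (fun s => by
    rw [deriv_fun_sub (hφ s) (by fun_prop), h, deriv_const_mul_field]; simp) b a
  linarith

lemma lieDerivMetric_sub {X Y : EuclideanSpace ℝ (Fin n) → Fin n → ℝ}
    (hX : ∀ i, DifferentiableAt ℝ (fun z => X z i) y)
    (hY : ∀ i, DifferentiableAt ℝ (fun z => Y z i) y) (i j : Fin n) :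
    lieDerivMetric (fun z k => X z k - Y z k) G i j y
      = lieDerivMetric X G i j y - lieDerivMetric Y G i j y := by
  unfold lieDerivMetric
  rw [← Finset.sum_sub_distrib]
  refine Finset.sum_congr rfl fun k _ => ?_
  rw [pd_sub i (hX k) (hY k), pd_sub j (hX k) (hY k)]
  ring

/-- The scalar curvature is defined through a chart that varies with the point, so its smoothness is
not immediate. Tracing the Einstein equation in one fixed chart recovers $c$ as a smooth expression
in the metric. -/
lemma IsMetricOn.contDiffOn_einstein_factor (hG : IsMetricOn G U)
    {c : EuclideanSpace ℝ (Fin n) → ℝ} (hn : n ≠ 0)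
    (hric : ∀ z ∈ U, ∀ j k, ricci G j k z = c z * G z j k) : ContDiffOn ℝ ∞ c U := by
  have h : ContDiffOn ℝ ∞ (fun z => (n : ℝ)⁻¹ * ∑ j, ∑ k, (G z)⁻¹ j k * ∑ p, curv G p k z p j) U :=
    contDiffOn_const.mul (ContDiffOn.sum fun j _ => ContDiffOn.sum fun k _ =>
      (hG.inv_smooth j k).mul (ContDiffOn.sum fun p _ => hG.curv_smooth p k p j))
  refine h.congr fun z hz => ?_
  simp only [← hG.ricci_eq_curv hz, hric z hz]
  have h1 : ∀ j, ∑ k, (G z)⁻¹ j k * (c z * G z j k) = c z := by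
    intro j
    have h2 := congrFun (congrFun (hG.inv_mul hz) j) j
    rw [Matrix.mul_apply, Matrix.one_apply_eq] at h2
    refine Eq.trans ?_ (mul_one (c z))
    rw [← h2, Finset.mul_sum]
    exact Finset.sum_congr rfl fun k _ => by rw [hG.apply_comm hz j k]; ring
  have hn' : (n : ℝ) ≠ 0 := Nat.cast_ne_zero.2 hn
  simp only [h1, Finset.sum_const, Finset.card_univ, Fintype.card_fin, nsmul_eq_mul]
  field_simp

end LocalCalculus

/-! ### Global consequences on the connected manifold. -/

section Global

variable {n : ℕ} {M : Type*} [TopologicalSpace M] [ChartedSpace (EuclideanSpace ℝ (Fin n)) M]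
  {e : OpenPartialHomeomorph M (EuclideanSpace ℝ (Fin n))} {y : EuclideanSpace ℝ (Fin n)}

/-- The function is constant on the part of a chart domain lying over a ball, hence locally
constant, hence constant by connectedness. -/
lemma eq_of_pd_eq_zero [ConnectedSpace M] {F : M → ℝ}
    (hd : ∀ x : M, DifferentiableOn ℝ
      (fun z => F ((chartAt (EuclideanSpace ℝ (Fin n)) x).symm z))
      (chartAt (EuclideanSpace ℝ (Fin n)) x).target)
    (h : ∀ x : M, ∀ y ∈ (chartAt (EuclideanSpace ℝ (Fin n)) x).target, ∀ i,
      pd i (fun z => F ((chartAt (EuclideanSpace ℝ (Fin n)) x).symm z)) y = 0) (x x' : M) :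
    F x = F x' := by
  refine IsLocallyConstant.apply_eq_of_preconnectedSpace
    ((IsLocallyConstant.iff_eventually_eq F).2 fun x => ?_) x x'
  set e := chartAt (EuclideanSpace ℝ (Fin n)) x with he
  have hx : x ∈ e.source := mem_chart_source _ x
  obtain ⟨r, hr, hball⟩ := Metric.isOpen_iff.1 e.open_target (e x) (e.map_source hx)
  have hnhds : ∀ᶠ x' in nhds x, e x' ∈ Metric.ball (e x) r :=
    (e.continuousAt hx).eventually (Metric.ball_mem_nhds _ hr)
  filter_upwards [hnhds, e.open_source.mem_nhds hx] with x' h1 h2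
  have h3 := (Metric.isOpen_ball (x := e x) (ε := r)).is_const_of_fderiv_eq_zero
    (convex_ball (e x) r).isPreconnected ((hd x).mono hball)
    (fun z hz => fderiv_eq_zero_of_pd_eq_zero (h x z (hball hz))) h1 (Metric.mem_ball_self hr)
  have h4 : F (e.symm (e x')) = F (e.symm (e x)) := h3
  rwa [e.left_inv h2, e.left_inv hx] at h4

lemma pd_comp_symm_eq_mfderiv (he : e ∈ IsManifold.maximalAtlas (𝓡 n) ∞ M) (hy : y ∈ e.target)
    {S : M → ℝ} (hS : MDifferentiableAt (𝓡 n) 𝓘(ℝ, ℝ) S (e.symm y)) (i : Fin n) :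
    pd i (fun z => S (e.symm z)) y = mfderiv (𝓡 n) 𝓘(ℝ, ℝ) S (e.symm y) (coordVec e i y) := by
  have h := mfderiv_comp y hS ((mdifferentiable_of_mem_maximalAtlas he).mdifferentiableAt_symm hy)
  rw [mfderiv_eq_fderiv] at h
  exact congrArg (fun T => T (EuclideanSpace.single i (1 : ℝ))) h

section Families

variable {η : ℝ → ∀ x : M, TangentSpace (𝓡 n) x} {ξ : ℝ → M → ℝ}

lemma contDiffOn_comp_slice [IsManifold (𝓡 n) ∞ M]
    (hη : ContMDiff (𝓘(ℝ, ℝ).prod (𝓡 n)) (𝓡 n).tangent ∞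
      (fun p : ℝ × M => (⟨p.2, η p.1 p.2⟩ : TangentBundle (𝓡 n) M)))
    (he : e ∈ IsManifold.maximalAtlas (𝓡 n) ∞ M) (t : ℝ) (i : Fin n) :
    ContDiffOn ℝ ∞ (fun z => comp e (η t) z i) e.target :=
  (contDiffOn_comp_family hη he i).comp (contDiff_const.prodMk contDiff_id).contDiffOn
    fun _ hz => ⟨trivial, hz⟩

lemma differentiable_comp_time [IsManifold (𝓡 n) ∞ M]
    (hη : ContMDiff (𝓘(ℝ, ℝ).prod (𝓡 n)) (𝓡 n).tangent ∞
      (fun p : ℝ × M => (⟨p.2, η p.1 p.2⟩ : TangentBundle (𝓡 n) M)))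
    (he : e ∈ IsManifold.maximalAtlas (𝓡 n) ∞ M) (hy : y ∈ e.target) (i : Fin n) :
    Differentiable ℝ (fun s => comp e (η s) y i) :=
  (contDiffOn_univ.1 ((contDiffOn_comp_family hη he i).comp (s := Set.univ)
    (contDiff_id.prodMk contDiff_const).contDiffOn fun _ _ => ⟨trivial, hy⟩)).differentiable
    (by simp)

lemma contDiffOn_slice
    (hξ : ContMDiff (𝓘(ℝ, ℝ).prod (𝓡 n)) 𝓘(ℝ, ℝ) ∞ (fun p : ℝ × M => ξ p.1 p.2))
    (he : e ∈ IsManifold.maximalAtlas (𝓡 n) ∞ M) (t : ℝ) :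
    ContDiffOn ℝ ∞ (fun z => ξ t (e.symm z)) e.target :=
  (contDiffOn_family hξ he).comp (contDiff_const.prodMk contDiff_id).contDiffOn
    fun _ hz => ⟨trivial, hz⟩

lemma differentiable_time
    (hξ : ContMDiff (𝓘(ℝ, ℝ).prod (𝓡 n)) 𝓘(ℝ, ℝ) ∞ (fun p : ℝ × M => ξ p.1 p.2))
    (he : e ∈ IsManifold.maximalAtlas (𝓡 n) ∞ M) (hy : y ∈ e.target) :
    Differentiable ℝ (fun s => ξ s (e.symm y)) :=
  (contDiffOn_univ.1 ((contDiffOn_family hξ he).comp (s := Set.univ)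
    (contDiff_id.prodMk contDiff_const).contDiffOn fun _ _ => ⟨trivial, hy⟩)).differentiable
    (by simp)

lemma eq_of_deriv_time_eq_zero [IsManifold (𝓡 n) ∞ M]
    (hξ : ContMDiff (𝓘(ℝ, ℝ).prod (𝓡 n)) 𝓘(ℝ, ℝ) ∞ (fun p : ℝ × M => ξ p.1 p.2))
    (h : ∀ e ∈ IsManifold.maximalAtlas (𝓡 n) ∞ M, ∀ y ∈ e.target, ∀ t,
      deriv (fun s => ξ s (e.symm y)) t = 0) (s t : ℝ) (x : M) : ξ s x = ξ t x := by
  set e := chartAt (EuclideanSpace ℝ (Fin n)) x with hedef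
  have he : e ∈ IsManifold.maximalAtlas (𝓡 n) ∞ M := IsManifold.chart_mem_maximalAtlas x
  have hx : x ∈ e.source := mem_chart_source _ x
  have h1 := is_const_of_deriv_eq_zero (differentiable_time hξ he (e.map_source hx))
    (h e he _ (e.map_source hx)) s t
  rwa [e.left_inv hx] at h1

end Families

variable [IsManifold (𝓡 n) ∞ M] {g : Metric n M}

/-- In dimension zero the scalar curvature is an empty sum. -/
lemma dim_ne_zero [ConnectedSpace M] (hR : ∀ x : M, g.scalarCurvature x ≠ 0) : n ≠ 0 := by
  rintro rfl
  obtain ⟨x⟩ := (inferInstance : Nonempty M)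
  exact hR x (by simp [Metric.scalarCurvature, scalar])

/-- The curvature scalar of an Einstein space of dimension `n > 2` is constant. -/
lemma scalarCurvature_eq_of_two_lt [ConnectedSpace M] (hE : g.IsEinstein) (hn : 2 < n)
    (x x' : M) : g.scalarCurvature x = g.scalarCurvature x' := by
  have hc : ∀ e ∈ IsManifold.maximalAtlas (𝓡 n) ∞ M,
      ContDiffOn ℝ ∞ (fun z => g.scalarCurvature (e.symm z) / n) e.target := fun e he =>
    (isMetricOn_matrix g he).contDiffOn_einstein_factor (by omega) (hE e he)
  have h : ∀ x x' : M, g.scalarCurvature x / n = g.scalarCurvature x' / n := by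
    refine eq_of_pd_eq_zero (n := n) (fun x => ?_) fun x y hy i => ?_
    · exact (hc _ (IsManifold.chart_mem_maximalAtlas x)).differentiableOn (by simp)
    · have he := IsManifold.chart_mem_maximalAtlas (I := 𝓡 n) (n := ∞) x
      have h1 := (isMetricOn_matrix g he).pd_einstein_factor (hc _ he) (hE _ he) hy i
      have hn' : (2 : ℝ) < n := by exact_mod_cast hn
      exact (mul_eq_zero.1 h1).resolve_left (by linarith)
  have hn' : (n : ℝ) ≠ 0 := by exact_mod_cast (by omega : n ≠ 0)
  exact (div_left_inj' hn').1 (h x x')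

/-- A Killing field of a proper Einstein space is a gradient only where it vanishes. -/
lemma Metric.IsKilling.eq_zero_of_isGradientOn (hE : g.IsEinstein)
    (hR : ∀ x : M, g.scalarCurvature x ≠ 0) {D : ∀ x : M, TangentSpace (𝓡 n) x}
    (hD : g.IsKilling D) {U : Set M} (hU : IsOpen U) (hgrad : g.IsGradientOn D U) {x : M}
    (hx : x ∈ U) : D x = 0 := by
  obtain ⟨S, hS, hDS⟩ := hgrad
  set e := chartAt (EuclideanSpace ℝ (Fin n)) x with hedef
  have he : e ∈ IsManifold.maximalAtlas (𝓡 n) ∞ M := IsManifold.chart_mem_maximalAtlas x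
  have hxe : x ∈ e.source := mem_chart_source _ x
  -- The potential exists only on $U$, so the chart is shrunk to the part over $U$.
  have hVU : e.target ∩ e.symm ⁻¹' U ⊆ e.target := Set.inter_subset_left
  have hG := (isMetricOn_matrix g he).mono (e.isOpen_inter_preimage_symm hU) hVU
  have hDs : ∀ i, ContDiffOn ℝ ∞ (fun z => comp e D z i) (e.target ∩ e.symm ⁻¹' U) := fun i =>
    (contDiffOn_comp_slice (η := fun _ => D) (hD.contMDiff.comp
      (contMDiff_snd (I := 𝓘(ℝ, ℝ)) (M := ℝ))) he 0 i).mono hVU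
  have hSs : ContDiffOn ℝ ∞ (fun z => S (e.symm z)) (e.target ∩ e.symm ⁻¹' U) :=
    contMDiffOn_iff_contDiffOn.1 (hS.comp
      ((contMDiffOn_symm_of_mem_maximalAtlas he).mono hVU) fun z hz => hz.2)
  have hxV : e x ∈ e.target ∩ e.symm ⁻¹' U :=
    ⟨e.map_source hxe, by rwa [Set.mem_preimage, e.left_inv hxe]⟩
  by_cases hn : n = 0
  · subst hn
    exact absurd (by simp [Metric.scalarCurvature, scalar]) (hR x)
  have hc : g.scalarCurvature (e.symm (e x)) / n ≠ 0 :=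
    div_ne_zero (hR _) (Nat.cast_ne_zero.2 hn)
  have h0 := hG.eq_zero_of_gradient_killing hDs (fun z hz => hD.lie_eq_zero e he z hz.1) hSs
    (fun z hz i => by
      rw [pd_comp_symm_eq_mfderiv he hz.1 ((hS.contMDiffAt (hU.mem_nhds hz.2)).mdifferentiableAt
        (by simp)) i, ← hDS _ hz.2, val_eq_sum g he hz.1 D]
      exact Finset.sum_congr rfl fun k _ => by rw [hG.apply_comm hz i k]
    ) hxV hc (hE e he _ hxV.1)
  have h1 := sum_comp_smul_coordVec he hxV.1 D
  simp only [h0, Pi.zero_apply, zero_smul, Finset.sum_const_zero] at h1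
  rwa [e.left_inv hxe] at h1

namespace Metric.IsNoetherWithGauge

variable {ξ f : ℝ → M → ℝ} {η : ℝ → ∀ x : M, TangentSpace (𝓡 n) x}

/-- The determining equations in the chart `e`. -/
lemma determining (h : g.IsNoetherWithGauge ξ η f) (he : e ∈ IsManifold.maximalAtlas (𝓡 n) ∞ M)
    (hy : y ∈ e.target) (t : ℝ) :
    (∀ k, pd k (fun z => ξ t (e.symm z)) y = 0) ∧
      (∀ i j, lieDerivMetric (comp e (η t)) (g.matrix e) i j y
        = deriv (fun s => ξ s (e.symm y)) t * g.matrix e y i j) ∧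
      (∀ j, ∑ i, g.matrix e y j i * deriv (fun s => comp e (η s) y i) t
        = pd j (fun z => f t (e.symm z)) y) ∧
      deriv (fun s => f s (e.symm y)) t = 0 :=
  ((isMetricOn_matrix g he).noether_iff (ξ := fun s z => ξ s (e.symm z))
    (f := fun s z => f s (e.symm z)) (η := fun s => comp e (η s)) hy t).1 (h.noether e he t y hy)

lemma gauge_eq (h : g.IsNoetherWithGauge ξ η f) (s t : ℝ) (x : M) : f s x = f t x :=
  eq_of_deriv_time_eq_zero h.contMDiff_gauge (fun _ he _ hy t => (h.determining he hy t).2.2.2) s t x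

lemma xi_eq_of_point [ConnectedSpace M] (h : g.IsNoetherWithGauge ξ η f) (t : ℝ) (x x' : M) :
    ξ t x = ξ t x' :=
  eq_of_pd_eq_zero
    (fun x => (contDiffOn_slice h.contMDiff_xi (IsManifold.chart_mem_maximalAtlas x)
      t).differentiableOn (by simp))
    (fun x _ hy => (h.determining (IsManifold.chart_mem_maximalAtlas x) hy t).1) x x'

/-- The time derivative of `η` does not depend on the time. -/
lemma deriv_eta_eq (h : g.IsNoetherWithGauge ξ η f)
    (he : e ∈ IsManifold.maximalAtlas (𝓡 n) ∞ M) (hy : y ∈ e.target) (i : Fin n) (t : ℝ) :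
    deriv (fun s => comp e (η s) y i) t = deriv (fun s => comp e (η s) y i) 0 := by
  have hG := isMetricOn_matrix g he
  have hf : (fun z => f t (e.symm z)) = fun z => f 0 (e.symm z) :=
    funext fun z => h.gauge_eq t 0 _
  have h1 := hG.eq_zero_of_mulVec_eq_zero hy (v := fun i =>
    deriv (fun s => comp e (η s) y i) t - deriv (fun s => comp e (η s) y i) 0) (by
      ext j
      change ∑ i, g.matrix e y j i * (_ - _) = (0 : ℝ)
      simp only [mul_sub, Finset.sum_sub_distrib]
      rw [(h.determining he hy t).2.2.1, (h.determining he hy 0).2.2.1, hf, sub_self])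
  exact sub_eq_zero.1 (congrFun h1 i)

/-- $\eta$ is affine in $t$. Thus $\eta_t$ is a difference of two slices, and inherits smoothness
and the Killing equation without differentiating that equation in time. -/
lemma eta_sub_eq (h : g.IsNoetherWithGauge ξ η f)
    (he : e ∈ IsManifold.maximalAtlas (𝓡 n) ∞ M) (hy : y ∈ e.target) (i : Fin n) (a b : ℝ) :
    comp e (η b) y i - comp e (η a) y i = deriv (fun s => comp e (η s) y i) 0 * (b - a) :=
  sub_eq_of_forall_deriv_eq (differentiable_comp_time h.contMDiff_eta he hy i)
    (h.deriv_eta_eq he hy i) a b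

variable [ConnectedSpace M] {r : ℝ}

/-- As $\xi$ depends on $t$ alone, each slice $\eta(t)$ is homothetic with factor constant in space,
and `homothetic_factor` applies. -/
lemma deriv_xi_eq_zero (h : g.IsNoetherWithGauge ξ η f) (hE : g.IsEinstein) (hn : n ≠ 0)
    (hr : r ≠ 0) (hR : ∀ x : M, g.scalarCurvature x = r)
    (he : e ∈ IsManifold.maximalAtlas (𝓡 n) ∞ M) (hy : y ∈ e.target) (t : ℝ) :
    deriv (fun s => ξ s (e.symm y)) t = 0 := by
  have hn' : (n : ℝ) ≠ 0 := Nat.cast_ne_zero.2 hn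
  have hx : ∀ z, (fun s => ξ s (e.symm z)) = fun s => ξ s (e.symm y) := fun z =>
    funext fun s => h.xi_eq_of_point s _ _
  have h1 := (isMetricOn_matrix g he).homothetic_factor (c := r / n)
    (contDiffOn_comp_slice h.contMDiff_eta he t)
    (fun z hz i j => by rw [(h.determining he hz t).2.1 i j, hx z])
    (fun z hz j k => by rw [hE e he z hz, hR]) hy
  have h2 := (mul_eq_zero.1 h1).resolve_left (div_ne_zero hr hn')
  exact (mul_eq_zero.1 h2).resolve_right hn'

lemma lie_eq_zero (h : g.IsNoetherWithGauge ξ η f) (hE : g.IsEinstein) (hn : n ≠ 0)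
    (hr : r ≠ 0) (hR : ∀ x : M, g.scalarCurvature x = r)
    (he : e ∈ IsManifold.maximalAtlas (𝓡 n) ∞ M) (hy : y ∈ e.target) (t : ℝ) (i j : Fin n) :
    lieDerivMetric (comp e (η t)) (g.matrix e) i j y = 0 := by
  rw [(h.determining he hy t).2.1, h.deriv_xi_eq_zero hE hn hr hR he hy, zero_mul]

lemma isKilling (h : g.IsNoetherWithGauge ξ η f) (hE : g.IsEinstein) (hn : n ≠ 0)
    (hr : r ≠ 0) (hR : ∀ x : M, g.scalarCurvature x = r) (t : ℝ) : g.IsKilling (η t) where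
  contMDiff := h.contMDiff_eta.comp (contMDiff_const.prodMk contMDiff_id)
  lie_eq_zero _ he _ hy i j := h.lie_eq_zero hE hn hr hR he hy t i j

/-- `η` does not depend on the time, since its time derivative is a gradient Killing field. -/
lemma deriv_eta_eq_zero (h : g.IsNoetherWithGauge ξ η f) (hE : g.IsEinstein) (hn : n ≠ 0)
    (hr : r ≠ 0) (hR : ∀ x : M, g.scalarCurvature x = r)
    (he : e ∈ IsManifold.maximalAtlas (𝓡 n) ∞ M) (hy : y ∈ e.target) (i : Fin n) :
    deriv (fun s => comp e (η s) y i) 0 = 0 := by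
  have hG := isMetricOn_matrix g he
  have hs := fun (t : ℝ) (i : Fin n) => contDiffOn_comp_slice h.contMDiff_eta he t i
  have hK : ∀ z ∈ e.target, ∀ i, comp e (η 1) z i - comp e (η 0) z i
      = deriv (fun s => comp e (η s) z i) 0 := fun z hz i => by
    rw [h.eta_sub_eq he hz i 0 1]; ring
  have h0 := hG.eq_zero_of_gradient_killing (c := r / n)
    (η := fun z k => comp e (η 1) z k - comp e (η 0) z k)
    (fun i => (hs 1 i).sub (hs 0 i))
    (fun z hz i j => by
      rw [lieDerivMetric_sub (fun i => (hs 1 i).differentiableAt_of_isOpen hG.isOpen hz)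
        (fun i => (hs 0 i).differentiableAt_of_isOpen hG.isOpen hz),
        h.lie_eq_zero hE hn hr hR he hz, h.lie_eq_zero hE hn hr hR he hz, sub_zero])
    (contDiffOn_slice h.contMDiff_gauge he 0)
    (fun z hz j => by simp only [hK z hz]; exact (h.determining he hz 0).2.2.1 j)
    hy (div_ne_zero hr (Nat.cast_ne_zero.2 hn)) (fun j k => by rw [hE e he y hy, hR])
  rw [← hK y hy]
  exact congrFun h0 i

lemma eta_eq (h : g.IsNoetherWithGauge ξ η f) (hE : g.IsEinstein) (hn : n ≠ 0)
    (hr : r ≠ 0) (hR : ∀ x : M, g.scalarCurvature x = r) (t : ℝ) (x : M) : η t x = η 0 x := by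
  set e := chartAt (EuclideanSpace ℝ (Fin n)) x with hedef
  have he : e ∈ IsManifold.maximalAtlas (𝓡 n) ∞ M := IsManifold.chart_mem_maximalAtlas x
  have hx : x ∈ e.source := mem_chart_source _ x
  have h1 := eq_of_comp_eq he (e.map_source hx) (X := η t) (Y := η 0) fun i =>
    sub_eq_zero.1 (by
      rw [h.eta_sub_eq he (e.map_source hx), h.deriv_eta_eq_zero hE hn hr hR he (e.map_source hx),
        zero_mul])
  rwa [e.left_inv hx] at h1

/-- The spatial gradient of $f$ is $\eta_t$ with its index lowered, which vanishes. -/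
lemma gauge_eq_const (h : g.IsNoetherWithGauge ξ η f) (hE : g.IsEinstein) (hn : n ≠ 0)
    (hr : r ≠ 0) (hR : ∀ x : M, g.scalarCurvature x = r) : ∃ c, ∀ t x, f t x = c := by
  obtain ⟨x₀⟩ := (inferInstance : Nonempty M)
  refine ⟨f 0 x₀, fun t x => (h.gauge_eq t 0 x).trans ?_⟩
  refine eq_of_pd_eq_zero (n := n)
    (fun x => (contDiffOn_slice h.contMDiff_gauge (IsManifold.chart_mem_maximalAtlas x)
      0).differentiableOn (by simp)) (fun x y hy j => ?_) x x₀
  have he := IsManifold.chart_mem_maximalAtlas (I := 𝓡 n) (n := ∞) x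
  rw [← (h.determining he hy 0).2.2.1]
  simp only [h.deriv_eta_eq_zero hE hn hr hR he hy, mul_zero, Finset.sum_const_zero]

lemma xi_eq_const (h : g.IsNoetherWithGauge ξ η f) (hE : g.IsEinstein) (hn : n ≠ 0)
    (hr : r ≠ 0) (hR : ∀ x : M, g.scalarCurvature x = r) : ∃ L, ∀ t x, ξ t x = L := by
  obtain ⟨x₀⟩ := (inferInstance : Nonempty M)
  exact ⟨ξ 0 x₀, fun t x => (eq_of_deriv_time_eq_zero h.contMDiff_xi
    (fun _ he _ hy t => h.deriv_xi_eq_zero hE hn hr hR he hy t) t 0 x).trans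
      (h.xi_eq_of_point 0 x x₀)⟩

end Metric.IsNoetherWithGauge

/-- Time translations and Killing fields are Noether symmetries. -/
lemma Metric.IsKilling.isNoetherSymmetry {D : ∀ x : M, TangentSpace (𝓡 n) x}
    (hD : g.IsKilling D) (L : ℝ) : g.IsNoetherSymmetry (fun _ _ => L) (fun _ => D) := by
  refine ⟨fun _ _ => 0, contMDiff_const, hD.contMDiff.comp contMDiff_snd, contMDiff_const, ?_⟩
  intro e he t y hy
  refine ((isMetricOn_matrix g he).noether_iff (ξ := fun _ _ => L) (f := fun _ _ => 0)
    (η := fun _ => comp e D) hy t).2 ⟨fun k => ?_, fun i j => ?_, fun j => ?_, ?_⟩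
  · simp [pd]
  · rw [hD.lie_eq_zero e he y hy]; simp
  · simp [pd]
  · simp

end Global

end Geodesic

theorem theorem4 {n : ℕ} {M : Type*} [TopologicalSpace M]
    [ChartedSpace (EuclideanSpace ℝ (Fin n)) M] [IsManifold (𝓡 n) ∞ M] [ConnectedSpace M]
    (g : Geodesic.Metric n M) (hE : g.IsEinstein) (hR : ∀ x : M, g.scalarCurvature x ≠ 0)
    (hn : 2 < n ∨ ∃ c : ℝ, ∀ x : M, g.scalarCurvature x = c)
    (ξ : ℝ → M → ℝ) (η : ℝ → ∀ x : M, TangentSpace (𝓡 n) x) :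
    (g.IsNoetherSymmetry ξ η ↔
      ∃ (L : ℝ) (D : ∀ x : M, TangentSpace (𝓡 n) x), g.IsNonGradientKilling D ∧
        ∀ (t : ℝ) (x : M), ξ t x = L ∧ η t x = D x) ∧
    (∀ f : ℝ → M → ℝ, g.IsNoetherWithGauge ξ η f → ∃ c : ℝ, ∀ (t : ℝ) (x : M), f t x = c) := by
  have hn0 := Geodesic.dim_ne_zero hR
  obtain ⟨x₀⟩ := (inferInstance : Nonempty M)
  have hconst : ∀ x, g.scalarCurvature x = g.scalarCurvature x₀ := by
    rcases hn with hn | ⟨c, hc⟩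
    · exact fun x => Geodesic.scalarCurvature_eq_of_two_lt hE hn x x₀
    · exact fun x => (hc x).trans (hc x₀).symm
  refine ⟨⟨?_, ?_⟩, fun f h => h.gauge_eq_const hE hn0 (hR x₀) hconst⟩
  · rintro ⟨f, h⟩
    obtain ⟨L, hL⟩ := h.xi_eq_const hE hn0 (hR x₀) hconst
    have hK := h.isKilling hE hn0 (hR x₀) hconst 0
    -- The non-gradient clause costs nothing: it holds for every Killing field of a proper Einstein
    -- space.
    exact ⟨L, η 0, ⟨hK, fun U hU hgrad x hx => hK.eq_zero_of_isGradientOn hE hR hU hgrad hx⟩,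
      fun t x => ⟨hL t x, h.eta_eq hE hn0 (hR x₀) hconst t x⟩⟩
  · rintro ⟨L, D, hD, h⟩
    obtain rfl : ξ = fun _ _ => L := funext fun t => funext fun x => (h t x).1
    obtain rfl : η = fun _ => D := funext fun t => funext fun x => (h t x).2
    exact hD.isKilling.isNoetherSymmetry L
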